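/- Theorem 3.1. Let $X$ be a smooth ($C^\infty$) connected 2-dimensional Riemannian manifold without boundary, and let $Y \subset X$ be a compact connected 2-dimensional $C^0$-submanifold with (possibly empty) boundary, that is, a compact connected subset which, with the subspace topology, is a topological 2-manifold with boundary. Let $\operatorname{Int} Y$ be the interior of $Y$ in $X$. For $x, y \in Y$ put $$\rho_Y(x,y) = \liminf_{\substack{x' \to x,\ y' \to y\\ x', y' \in \operatorname{Int} Y}} \ \inf_{\gamma} l(\gamma) \in [0,\infty],$$ where the infimum is taken over all smooth paths $\gamma : [0,1] \to \operatorname{Int} Y$ with $\gamma(0) = x'$ and $\gamma(1) = y'$, and $l(\gamma)$ is the Riemannian length of $\gamma$. If (i) $\rho_Y(x,y) < \infty$ for all $x, y \in Y$, then $\rho_Y$ is a metric on $Y$. -/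

import Mathlib

open scoped Manifold ContDiff Topology ENNReal Bundle
open Bundle

/-- A subset `Y` of a topological space is a two-dimensional `C^0`-submanifold with (possibly empty)
boundary if, with the subspace topology, it is locally homeomorphic to open subsets of the closed
half-plane. -/
def IsC0SurfaceWithBoundary {X : Type*} [TopologicalSpace X] (Y : Set X) : Prop :=
  Nonempty (ChartedSpace (EuclideanHalfSpace 2) Y)

section

variable {X : Type*} [TopologicalSpace X] [ChartedSpace (EuclideanSpace ℝ (Fin 2)) X]
  [IsManifold (𝓡 2) ∞ X] [RiemannianBundle (fun x : X => TangentSpace (𝓡 2) x)]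

/-- The infimum of the Riemannian lengths of the smooth paths `[0,1] → S` from `x` to `y`
(`∞` if there is no such path). -/
noncomputable def smoothPathInf (S : Set X) (x y : X) : ℝ≥0∞ :=
  sInf {ℓ : ℝ≥0∞ | ∃ γ : ℝ → X,
    ContMDiffOn 𝓘(ℝ, ℝ) (𝓡 2) ∞ γ (Set.Icc 0 1) ∧ Set.MapsTo γ (Set.Icc 0 1) S ∧
    γ 0 = x ∧ γ 1 = y ∧ ℓ = Manifold.pathELength (𝓡 2) γ 0 1}

/-- The function `ρ_Y`: the lower limit, as `x' → x` and `y' → y` with `x', y' ∈ Int Y`, of the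
infimum of the lengths of smooth paths joining `x'` and `y'` in `Int Y`. -/
noncomputable def intrinsicRho (Y : Set X) (x y : X) : ℝ≥0∞ :=
  Filter.liminf (fun p : X × X => smoothPathInf (interior Y) p.1 p.2)
    (𝓝[interior Y] x ×ˢ 𝓝[interior Y] y)

end

/-!
`intrinsicRho Y` vanishes on the diagonal because of constant paths, is symmetric because paths can
be reversed, and separates points because it is at least the Riemannian distance of `X`. Besides
making the values real, the finiteness hypothesis implies that every point of `Y` is a limit of
interior points, since a limit inferior along the trivial filter is `⊤`. The substance of the theorem
is the triangle inequality at a boundary point `y`, which fails in higher dimensions.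

Take paths `α` and `β` in `Int Y` that start near `x` and near `z` and end near `y`. The claim is
that, for every small `r`, some arc of the circle `S` of radius `r` about `y`, taken in a chart of
`X`, stays in `Int Y` and joins a point of `α` to a point of `β` (`exists_arcJoined_of_paths`). The
length of this arc is `O(r)`, so following `α`, then the arc, then `β` backwards yields a path from
near `x` to near `z` of length at most the sum of the two lengths plus `O(r)`.

To see the claim, parametrize a neighbourhood of `y` in `Y` by a half-disc
(`IsC0SurfaceWithBoundary.exists_halfDiscChart`). By invariance of domain in the plane
(`Complex.isOpen_image_of_injOn`) the open half-disc is exactly the part of the neighbourhood lying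
in `Int Y`. If the claim fails, the trace of `S` on the open half-disc is a disjoint union of two
closed sets: the set `A` of points joined to `α` by an arc of `S` within `Int Y`, and its
complement `B`. The final piece of `α` leads from a half-circle outside `S` to a point inside `S`
and avoids `B`. The final piece of `β`, completed by part of that half-circle and by a short
segment near `y`, joins the same two points and avoids `A`. By a case of Janiszewski's theorem
(`not_separated_of_disjoint_closed`) the two points are not separated by `A ∪ B`, that is, by `S`,
which is absurd.

Invariance of domain and the case of Janiszewski's theorem both rest on the existence of continuous
logarithms on simply connected spaces.
-/

/-! ### Logarithms of continuous functions on simply connected spaces -/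

theorem exists_continuous_exp_eq {X : Type*} [TopologicalSpace X] [SimplyConnectedSpace X]
    [LocallyPathConnectedSpace X] {g : X → ℂ} (hg : Continuous g) (h0 : ∀ x, g x ≠ 0) :
    ∃ F : X → ℂ, Continuous F ∧ ∀ x, Complex.exp (F x) = g x := by
  obtain ⟨a⟩ := (inferInstance : Nonempty X)
  obtain ⟨F, ⟨-, hF⟩, -⟩ := Complex.isCoveringMapOn_exp.existsUnique_continuousMap_lifts
    ⟨g, hg⟩ (a₀ := a) (Complex.exp_log (h0 a)) (fun x => h0 x)
  exact ⟨F, F.continuous, fun x => congr_fun hF x⟩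

/-- Two continuous logarithms of the same function differ by a constant on a connected set; `k` stands
for their difference. -/
theorem IsPreconnected.eq_of_exp_eq_one {X : Type*} [TopologicalSpace X] {s : Set X}
    (hs : IsPreconnected s) {k : X → ℂ} (hk : ContinuousOn k s)
    (h1 : ∀ x ∈ s, Complex.exp (k x) = 1) {x y : X} (hx : x ∈ s) (hy : y ∈ s) : k x = k y := by
  have hd : DiscreteTopology (Complex.exp ⁻¹' {1}) :=
    (Complex.isCoveringMapOn_exp 1 one_ne_zero).1
  exact hs.constant_of_mapsTo ⟨hd⟩ hk (fun z hz => h1 z hz) hx hy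

/-- A continuous map of the closed unit disc to the plane which on the unit circle differs from the
identity by less than `1` has a zero. -/
theorem exists_zero_of_norm_sub_lt {g : ℂ → ℂ} (hg : ContinuousOn g (Metric.closedBall 0 1))
    (h : ∀ z : ℂ, ‖z‖ = 1 → ‖g z - z‖ < 1) : ∃ z ∈ Metric.closedBall (0 : ℂ) 1, g z = 0 := by
  by_contra! hne
  -- radial retraction onto the closed disc
  let ret : ℂ → ℂ := fun z => (↑(max 1 ‖z‖))⁻¹ * z
  have hret : Continuous ret := by
    refine Continuous.mul (Continuous.inv₀ (by fun_prop) fun z => ?_) continuous_id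
    exact_mod_cast (lt_of_lt_of_le one_pos (le_max_left _ _)).ne'
  have hret_mem : ∀ z, ret z ∈ Metric.closedBall (0 : ℂ) 1 := by
    intro z
    have h1 : 0 < max 1 ‖z‖ := lt_of_lt_of_le one_pos (le_max_left _ _)
    simp only [ret, mem_closedBall_zero_iff, norm_mul, norm_inv, Complex.norm_real,
      Real.norm_eq_abs, abs_of_pos h1]
    rw [inv_mul_le_iff₀ h1, mul_one]
    exact le_max_right _ _
  have hret_id : ∀ z : ℂ, ‖z‖ = 1 → ret z = z := by
    intro z hz
    simp [ret, hz]
  obtain ⟨F, hF, hFe⟩ := exists_continuous_exp_eq (hg.comp_continuous hret hret_mem)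
    (fun z => hne _ (hret_mem z))
  let c : ℝ → ℂ := fun θ => Complex.exp (θ * Complex.I)
  have hc : Continuous c := by fun_prop
  have hc1 : ∀ θ, ‖c θ‖ = 1 := fun θ => Complex.norm_exp_ofReal_mul_I θ
  have hc0 : ∀ θ, c θ ≠ 0 := fun θ => Complex.exp_ne_zero _
  have hslit : ∀ θ, g (c θ) / c θ ∈ Complex.slitPlane := by
    intro θ
    have h2 : ‖(g (c θ) - c θ) / c θ‖ < 1 := by
      rw [norm_div, hc1, div_one]
      exact h _ (hc1 θ)
    have h3 := Complex.mem_slitPlane_of_norm_lt_one h2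
    rwa [sub_div, div_self (hc0 θ), add_sub_cancel] at h3
  have hgc : Continuous fun θ => g (c θ) := hg.comp_continuous hc (fun θ => by simp [hc1])
  let k : ℝ → ℂ := fun θ => F (c θ) - θ * Complex.I - Complex.log (g (c θ) / c θ)
  have hk : Continuous k := by
    refine Continuous.sub (by fun_prop) ?_
    exact (hgc.div hc hc0).clog hslit
  have hk1 : ∀ θ, Complex.exp (k θ) = 1 := by
    intro θ
    have h1 : g (c θ) ≠ 0 := hne _ (by simp [hc1])
    simp only [k, Complex.exp_sub, hFe, Function.comp, hret_id _ (hc1 θ)]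
    rw [Complex.exp_log (div_ne_zero h1 (hc0 θ))]
    have := hc0 θ
    simp only [c] at *
    field_simp
  have := isPreconnected_univ.eq_of_exp_eq_one hk.continuousOn (fun x _ => hk1 x)
    (Set.mem_univ 0) (Set.mem_univ (2 * Real.pi))
  have hcc : c (2 * Real.pi) = c 0 := by simp [c]
  simp only [k, hcc] at this
  have hpi := Complex.two_pi_I_ne_zero
  apply hpi
  push_cast at this
  linear_combination this


/-! ### Invariance of domain in the plane -/

/-- The centre of the unit disc is mapped to an interior point by every injective continuous map of
the disc to the plane. If it were not, the inverse map, extended to the plane, could be perturbed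
on the image by less than `1` so as to lose its only zero. -/
theorem mem_interior_image_unitDisc {f : ℂ → ℂ} (hf : ContinuousOn f (Metric.closedBall 0 1))
    (hinj : Set.InjOn f (Metric.closedBall 0 1)) :
    f 0 ∈ interior (f '' Metric.closedBall 0 1) := by
  by_contra hint
  set D : Set ℂ := Metric.closedBall 0 1 with hD
  set K : Set ℂ := f '' D with hK
  have hDc : IsCompact D := isCompact_closedBall 0 1
  have hKc : IsCompact K := hDc.image_of_continuousOn hf
  have h0D : (0 : ℂ) ∈ D := by simp [hD]
  -- the inverse map, extended to the whole plane
  obtain ⟨G, hG⟩ : ∃ G : C(ℂ, ℂ), ∀ z ∈ D, G (f z) = z := by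
    have : CompactSpace D := isCompact_iff_compactSpace.1 hDc
    have hcont : Continuous (D.domRestrict f) := continuousOn_iff_continuous_domRestrict.1 hf
    have hemb : Topology.IsClosedEmbedding (D.domRestrict f) :=
      hcont.isClosedEmbedding (Set.injOn_iff_injective.1 hinj)
    obtain ⟨G, hG⟩ := ContinuousMap.exists_extension hemb ⟨Subtype.val, continuous_subtype_val⟩
    exact ⟨G, fun z hz => congr($hG ⟨z, hz⟩)⟩
  have hGp : G (f 0) = 0 := hG 0 h0D
  obtain ⟨ε, hε, hGε⟩ : ∃ ε > 0, ∀ y, dist y (f 0) < 2 * ε → ‖G y‖ < 1 / 4 := by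
    obtain ⟨δ, hδ, h⟩ := Metric.continuousAt_iff.1 G.continuous.continuousAt (1 / 4) (by norm_num)
    refine ⟨δ / 2, by positivity, fun y hy => ?_⟩
    have := h (x := y) (by linarith)
    rwa [hGp, dist_zero_right] at this
  -- a centre outside `K` from which to push
  obtain ⟨c, hcK, hc⟩ : ∃ c ∉ K, dist c (f 0) < ε := by
    by_contra! hcon
    refine hint (mem_interior_iff_mem_nhds.2 (Metric.mem_nhds_iff.2 ⟨ε, hε, fun c hcε => ?_⟩))
    by_contra hcK
    exact absurd hcε (by simpa using hcon c hcK)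
  have hGc : ∀ y, dist y c ≤ ε → ‖G y‖ < 1 / 4 := fun y hy => hGε y (by
    have := dist_triangle y c (f 0)
    linarith)
  set S : Set ℂ := K ∩ {y | ε ≤ dist y c} with hS
  have hSc : IsCompact S := hKc.inter_right (isClosed_le continuous_const (by fun_prop))
  obtain ⟨δ, hδ, hδ4, hGS⟩ : ∃ δ > 0, δ ≤ 1 / 4 ∧ ∀ y ∈ S, δ ≤ ‖G y‖ := by
    have hne : ∀ y ∈ S, 0 < ‖G y‖ := by
      rintro _ ⟨⟨z, hz, rfl⟩, hy⟩
      rw [hG z hz, norm_pos_iff]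
      rintro rfl
      rw [dist_comm] at hc
      exact absurd hc (not_lt.2 hy)
    obtain ⟨m, hm, hmS⟩ := hSc.exists_forall_le' (f := fun y => ‖G y‖)
      (by fun_prop) (a := 0) hne
    exact ⟨min m (1 / 4), by positivity, min_le_right _ _, fun y hy =>
      (min_le_left _ _).trans (hmS y hy)⟩
  -- a smooth approximation of `G`, translated so as to have no zero on the circle of radius `ε`
  obtain ⟨P, hPc, hPG, hP0⟩ : ∃ P : ℂ → ℂ, Continuous P ∧ (∀ y, ‖P y - G y‖ < δ) ∧
      ∀ y, dist y c = ε → P y ≠ 0 := by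
    obtain ⟨Q, hQ, hQG, -⟩ := G.continuous.exists_contDiff_approx 1
      (ε := fun _ => δ / 2) continuous_const (fun _ => by positivity)
    have hcirc : ContDiff ℝ 1 (fun θ : ℝ => Q (circleMap c ε θ)) :=
      hQ.comp (contDiff_circleMap c ε)
    have hdense := hcirc.dense_compl_range_of_finrank_lt_finrank (by simp)
    obtain ⟨w, hw, hwδ⟩ := Metric.dense_iff.1 hdense 0 (δ / 2) (by positivity)
    refine ⟨fun y => Q y - w, hQ.continuous.sub continuous_const, fun y => ?_, fun y hy h0 => ?_⟩
    · have h1 := hQG y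
      rw [dist_eq_norm] at h1
      have h2 : ‖w‖ < δ / 2 := by simpa using hw
      calc ‖Q y - w - G y‖ = ‖(Q y - G y) - w‖ := by ring_nf
        _ ≤ ‖Q y - G y‖ + ‖w‖ := norm_sub_le _ _
        _ < δ := by linarith
    · have : y ∈ Set.range (circleMap c ε) := by
        rw [range_circleMap, abs_of_pos hε]
        exact hy
      obtain ⟨θ, rfl⟩ := this
      exact hwδ ⟨θ, sub_eq_zero.1 h0⟩
  have hPS : ∀ y ∈ S, P y ≠ 0 := fun y hy h0 => by
    have := hPG y
    rw [h0, zero_sub, norm_neg] at this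
    exact absurd (hGS y hy) (not_le.2 this)
  -- radial push of `K` away from `c`
  -- (the identity at distance at least `ε`, projection to the circle of radius `ε` otherwise)
  let Φ : ℂ → ℂ := fun y => c + (↑(max (ε / ‖y - c‖) 1) : ℂ) * (y - c)
  have hne : ∀ y ∈ K, ‖y - c‖ ≠ 0 := fun y hy h0 => by
    rw [norm_eq_zero, sub_eq_zero] at h0
    exact hcK (h0 ▸ hy)
  have hΦ : ContinuousOn Φ K := by
    refine continuousOn_const.add (ContinuousOn.mul ?_ (by fun_prop))
    refine Complex.continuous_ofReal.comp_continuousOn (ContinuousOn.sup ?_ continuousOn_const)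
    exact continuousOn_const.div (by fun_prop) hne
  have hΦfar : ∀ y, ε ≤ dist y c → Φ y = y := by
    intro y hy
    rw [dist_eq_norm] at hy
    have : max (ε / ‖y - c‖) 1 = 1 := max_eq_right (div_le_one_of_le₀ hy (norm_nonneg _))
    simp [Φ, this]
  have hΦnear : ∀ y ∈ K, dist y c ≤ ε → dist (Φ y) c = ε := by
    intro y hyK hy
    rw [dist_eq_norm] at hy
    have h0 : 0 < ‖y - c‖ := lt_of_le_of_ne (norm_nonneg _) (hne y hyK).symm
    have : max (ε / ‖y - c‖) 1 = ε / ‖y - c‖ := max_eq_left ((one_le_div h0).2 hy)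
    rw [dist_eq_norm]
    simp only [Φ, this, add_sub_cancel_left, norm_mul, Complex.norm_real, Real.norm_eq_abs]
    rw [abs_of_pos (by positivity)]
    field_simp
  obtain ⟨z, hz, hz0⟩ := exists_zero_of_norm_sub_lt (g := fun z => P (Φ (f z)))
    (hPc.comp_continuousOn (hΦ.comp hf (Set.mapsTo_image f D))) (fun z hz => by
      have hzD : z ∈ D := by simp [hD, hz]
      have hfz : f z ∈ K := Set.mem_image_of_mem f hzD
      rcases le_total ε (dist (f z) c) with h | h
      · rw [hΦfar _ h]
        nth_rewrite 2 [← hG z hzD]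
        linarith [hPG (f z)]
      · have h1 := hPG (Φ (f z))
        have h2 := hGc _ (hΦnear _ hfz h).le
        have h3 := hGc _ h
        rw [hG z hzD] at h3
        calc ‖P (Φ (f z)) - z‖ = ‖(P (Φ (f z)) - G (Φ (f z))) + G (Φ (f z)) - z‖ := by ring_nf
          _ ≤ ‖P (Φ (f z)) - G (Φ (f z))‖ + ‖G (Φ (f z))‖ + ‖z‖ :=
            (norm_sub_le _ _).trans (by gcongr; exact norm_add_le _ _)
          _ < 1 := by linarith)
  have hfz : f z ∈ K := Set.mem_image_of_mem f hz
  rcases le_total ε (dist (f z) c) with h | h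
  · rw [hΦfar _ h] at hz0
    exact hPS _ ⟨hfz, h⟩ hz0
  · exact hP0 _ (hΦnear _ hfz h) hz0

/-- Invariance of domain in the plane. -/
theorem Complex.isOpen_image_of_injOn {U : Set ℂ} (hU : IsOpen U) {f : ℂ → ℂ}
    (hf : ContinuousOn f U) (hinj : Set.InjOn f U) : IsOpen (f '' U) := by
  rw [isOpen_iff_mem_nhds]
  rintro _ ⟨c, hc, rfl⟩
  obtain ⟨R, hR, hRU⟩ := Metric.nhds_basis_closedBall.mem_iff.1 (hU.mem_nhds hc)
  let a : ℂ → ℂ := fun z => c + R * z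
  have ha : Set.MapsTo a (Metric.closedBall 0 1) (Metric.closedBall c R) := by
    intro z hz
    rw [mem_closedBall_zero_iff] at hz
    simp only [a, Metric.mem_closedBall, dist_eq_norm, add_sub_cancel_left, norm_mul,
      Complex.norm_real, Real.norm_eq_abs, abs_of_pos hR]
    exact mul_le_of_le_one_right hR.le hz
  have hainj : Function.Injective a := fun z w h => by
    have : (R : ℂ) ≠ 0 := by exact_mod_cast hR.ne'
    simpa [a, this] using h
  have key := mem_interior_image_unitDisc (f := f ∘ a)
    (hf.comp (by fun_prop) (ha.mono_right hRU))
    (hinj.comp hainj.injOn (ha.mono_right hRU))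
  have ha0 : a 0 = c := by simp [a]
  rw [Function.comp_apply, ha0, mem_interior_iff_mem_nhds] at key
  refine Filter.mem_of_superset key ?_
  rintro _ ⟨z, hz, rfl⟩
  exact ⟨a z, hRU (ha hz), rfl⟩

/-! ### Separation by two disjoint closed sets -/

/-- A case of Janiszewski's theorem. Suppose that a level set of a continuous function on a simply
connected space is the union of two disjoint closed sets `A` and `B`, and that two points are
joined by a connected set avoiding `B` and by one avoiding `A`. Then the level set does not separate
them. The proof turns the two sides of the level set into a map to the unit circle which is `1`
on `A` and `-1` on `B`, and compares its logarithm at the two points along the two connected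
sets. -/
theorem not_separated_of_disjoint_closed {X : Type*} [TopologicalSpace X] [SimplyConnectedSpace X]
    [LocallyPathConnectedSpace X] [NormalSpace X] {u : X → ℝ} (hu : Continuous u) {r : ℝ}
    {A B : Set X} (hA : IsClosed A) (hB : IsClosed B) (hAB : Disjoint A B)
    (hur : ∀ x, u x = r → x ∈ A ∪ B) {E₁ E₂ : Set X} (hE₁ : IsPreconnected E₁)
    (hE₂ : IsPreconnected E₂) (hE₁B : Disjoint E₁ B) (hE₂A : Disjoint E₂ A) {p q : X}
    (hp₁ : p ∈ E₁) (hp₂ : p ∈ E₂) (hq₁ : q ∈ E₁) (hq₂ : q ∈ E₂) (hp : u p < r) :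
    u q ≤ r := by
  by_contra! hq
  obtain ⟨φ, hφA, hφB, -⟩ := exists_continuous_zero_one_of_isClosed hA hB hAB
  -- two logarithms: the first is continuous off `B`, the second off `A`
  let l₁ : X → ℂ := fun x => if u x ≤ r then φ x else -φ x
  let l₂ : X → ℂ := fun x => if u x ≤ r then φ x else 2 - φ x
  let e : ℂ → ℂ := fun z => Complex.exp (Real.pi * Complex.I * z)
  have he2 : ∀ z, e (2 + z) = e z := fun z => by
    simp only [e]
    rw [mul_add, Complex.exp_add, show (Real.pi * Complex.I * 2 : ℂ) = 2 * Real.pi * Complex.I by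
      ring, Complex.exp_two_pi_mul_I, one_mul]
  have he : Continuous e := by fun_prop
  have hφc : Continuous fun x => (φ x : ℂ) := Complex.continuous_ofReal.comp φ.continuous
  let g : X → ℂ := fun x => if u x ≤ r then e (φ x) else e (-φ x)
  have hg : Continuous g := by
    refine Continuous.if_le (he.comp hφc) (he.comp hφc.neg) hu continuous_const fun x hx => ?_
    rcases hur x hx with h | h
    · simp [hφA h]
    · simp only [hφB h, Pi.one_apply, Complex.ofReal_one]
      rw [← he2 (-1)]
      norm_num
  have hg₁ : ∀ x, g x = e (l₁ x) := fun x => by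
    simp only [g, l₁]
    split_ifs <;> rfl
  have hg₂ : ∀ x, g x = e (l₂ x) := fun x => by
    simp only [g, l₂]
    split_ifs
    · rfl
    · rw [sub_eq_add_neg, he2]
  have hl₁ : ContinuousOn l₁ E₁ := by
    rw [continuousOn_iff_continuous_domRestrict]
    refine Continuous.if_le (by fun_prop) (by fun_prop) (by fun_prop) continuous_const
      fun x hx => ?_
    have : (x : X) ∈ A := (hur x hx).resolve_right (Set.disjoint_left.1 hE₁B x.2)
    simp [hφA this]
  have hl₂ : ContinuousOn l₂ E₂ := by
    rw [continuousOn_iff_continuous_domRestrict]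
    refine Continuous.if_le (by fun_prop) (by fun_prop) (by fun_prop) continuous_const
      fun x hx => ?_
    have : (x : X) ∈ B := (hur x hx).resolve_left (Set.disjoint_left.1 hE₂A x.2)
    simp only [hφB this, Pi.one_apply, Complex.ofReal_one]
    norm_num
  obtain ⟨F, hF, hFg⟩ := exists_continuous_exp_eq hg (fun x => by
    rw [hg₁]
    exact Complex.exp_ne_zero _)
  have h₁ := hE₁.eq_of_exp_eq_one (k := fun x => F x - Real.pi * Complex.I * l₁ x)
    (by fun_prop) (fun x _ => by
      rw [Complex.exp_sub, hFg, hg₁]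
      exact div_self (Complex.exp_ne_zero _)) hp₁ hq₁
  have h₂ := hE₂.eq_of_exp_eq_one (k := fun x => F x - Real.pi * Complex.I * l₂ x)
    (by fun_prop) (fun x _ => by
      rw [Complex.exp_sub, hFg, hg₂]
      exact div_self (Complex.exp_ne_zero _)) hp₂ hq₂
  simp only [l₁, l₂, hp.le, hq.not_ge, if_true, if_false] at h₁ h₂
  exact Complex.two_pi_I_ne_zero (by linear_combination h₂ - h₁)

/-! ### Half-disc charts at boundary points -/

namespace EuclideanHalfSpace

/-- The closed half-plane as the subset `0 ≤ re` of the complex plane. -/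
noncomputable def toComplex (v : EuclideanHalfSpace 2) : ℂ := ⟨v.1 0, v.1 1⟩

/-- A left inverse of `toComplex`, obtained by cutting off negative real parts. -/
noncomputable def ofComplex (w : ℂ) : EuclideanHalfSpace 2 :=
  ⟨!₂[max w.re 0, w.im], by simp⟩

theorem continuous_toComplex : Continuous toComplex := by
  have h : toComplex = fun v => ((v.1 0 : ℝ) : ℂ) + ((v.1 1 : ℝ) : ℂ) * Complex.I := by
    ext1 v
    apply Complex.ext <;> simp [toComplex]
  have h1 : Continuous fun v : EuclideanHalfSpace 2 => v.1 := continuous_subtype_val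
  rw [h]
  fun_prop

theorem continuous_ofComplex : Continuous ofComplex := by
  refine Continuous.subtype_mk (f := fun w : ℂ => !₂[max w.re 0, w.im]) ?_ _
  refine (PiLp.continuous_toLp 2 _).comp (continuous_pi fun i => ?_)
  fin_cases i
  · exact Complex.continuous_re.max continuous_const
  · exact Complex.continuous_im

@[simp] theorem ofComplex_toComplex (v : EuclideanHalfSpace 2) : ofComplex (toComplex v) = v := by
  ext i
  have := v.2
  fin_cases i <;> simp [ofComplex, toComplex, this]

theorem toComplex_ofComplex {w : ℂ} (hw : 0 ≤ w.re) : toComplex (ofComplex w) = w := by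
  apply Complex.ext <;> simp [ofComplex, toComplex, hw]

theorem toComplex_re_nonneg (v : EuclideanHalfSpace 2) : 0 ≤ (toComplex v).re := v.2

end EuclideanHalfSpace

open EuclideanHalfSpace

section

variable {X : Type*} [TopologicalSpace X] {Y : Set X}

/-- A chart of `Y` with values in the half-plane, viewed as a map from `X` to `ℂ`. It takes the
junk value `0` off `Y`. -/
noncomputable def complexCoord (h : OpenPartialHomeomorph Y (EuclideanHalfSpace 2)) (x : X) : ℂ :=
  open Classical in if hx : x ∈ Y then toComplex (h ⟨x, hx⟩) else 0

@[simp] theorem complexCoord_coe (h : OpenPartialHomeomorph Y (EuclideanHalfSpace 2)) (p : Y) :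
    complexCoord h p = toComplex (h p) := by
  simp [complexCoord]

theorem continuousOn_complexCoord (h : OpenPartialHomeomorph Y (EuclideanHalfSpace 2)) :
    ContinuousOn (complexCoord h) ((↑) '' h.source) := by
  rintro _ ⟨p, hp, rfl⟩
  have h1 : ContinuousWithinAt (complexCoord h) Y p := by
    rw [ContinuousWithinAt, nhdsWithin_eq_map_subtype_coe p.2, Filter.tendsto_map'_iff]
    have : complexCoord h ∘ ((↑) : Y → X) = toComplex ∘ h := by
      ext1 q
      simp
    rw [this, complexCoord_coe]
    exact (continuous_toComplex.continuousAt.comp (h.continuousAt hp))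
  exact h1.mono (by rintro _ ⟨q, -, rfl⟩; exact q.2)

theorem injOn_complexCoord (h : OpenPartialHomeomorph Y (EuclideanHalfSpace 2)) :
    Set.InjOn (complexCoord h) ((↑) '' h.source) := by
  rintro _ ⟨p, hp, rfl⟩ _ ⟨q, hq, rfl⟩ hpq
  rw [complexCoord_coe, complexCoord_coe] at hpq
  have := congrArg ofComplex hpq
  rw [ofComplex_toComplex, ofComplex_toComplex] at this
  rw [h.injOn hp hq this]

/-- By invariance of domain, the points of `Y` that are topologically interior in `X` are those
that a boundary chart sends to the open half-plane. -/
theorem mem_interior_iff_of_halfPlane_chart (h : OpenPartialHomeomorph Y (EuclideanHalfSpace 2))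
    {p : Y} (hp : p ∈ h.source) (ψ : OpenPartialHomeomorph X ℂ) (hψ : (p : X) ∈ ψ.source) :
    (p : X) ∈ interior Y ↔ 0 < (toComplex (h p)).re := by
  constructor
  · intro hpi
    obtain ⟨O, hO, hOs⟩ := isOpen_induced_iff.1 h.open_source
    have hOY : O ∩ interior Y ⊆ (↑) '' h.source := fun x hx =>
      ⟨⟨x, interior_subset hx.2⟩, hOs ▸ hx.1, rfl⟩
    set G : Set ℂ := ψ.target ∩ ψ.symm ⁻¹' (O ∩ interior Y) with hG
    have hGo : IsOpen G := ψ.symm.isOpen_inter_preimage (hO.inter isOpen_interior)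
    have hopen := Complex.isOpen_image_of_injOn (f := complexCoord h ∘ ψ.symm) hGo
      ((continuousOn_complexCoord h).comp (ψ.continuousOn_symm.mono Set.inter_subset_left)
        fun w hw => hOY hw.2)
      ((injOn_complexCoord h).comp (ψ.symm.injOn.mono Set.inter_subset_left)
        fun w hw => hOY hw.2)
    have hmem : toComplex (h p) ∈ complexCoord h ∘ ψ.symm '' G := by
      refine ⟨ψ p, ⟨ψ.map_source hψ, ?_⟩, ?_⟩
      · rw [Set.mem_preimage, ψ.left_inv hψ]
        exact ⟨by rw [← hOs] at hp; exact hp, hpi⟩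
      · simp [ψ.left_inv hψ]
    refine lt_of_le_of_ne (toComplex_re_nonneg _) fun h0 => ?_
    -- an open set meeting the line `re = 0` leaves the half-plane
    have hc : ContinuousAt (fun t : ℝ => toComplex (h p) - (t : ℂ)) 0 := by fun_prop
    have := hc.preimage_mem_nhds (t := complexCoord h ∘ ψ.symm '' G) (by
      simpa using hopen.mem_nhds hmem)
    obtain ⟨ε, hε, hball⟩ := Metric.mem_nhds_iff.1 this
    obtain ⟨w, hw, hwe⟩ := hball (show ε / 2 ∈ Metric.ball 0 ε by
      simp [abs_of_pos hε, hε])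
    obtain ⟨q, -, hq⟩ := hOY hw.2
    have h2 : 0 ≤ (complexCoord h (ψ.symm w)).re := by
      rw [← hq, complexCoord_coe]
      exact toComplex_re_nonneg _
    simp only [Function.comp_apply] at hwe
    rw [hwe, Complex.sub_re, ← h0, Complex.ofReal_re] at h2
    linarith
  · intro hre
    let j : ℂ → X := fun w => h.symm (ofComplex w)
    set D : Set ℂ := {w | 0 < w.re} ∩
      ofComplex ⁻¹' (h.target ∩ h.symm ⁻¹' ((↑) ⁻¹' ψ.source)) with hD
    have hDo : IsOpen D := by
      refine (isOpen_lt continuous_const Complex.continuous_re).inter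
        (IsOpen.preimage continuous_ofComplex ?_)
      exact h.symm.isOpen_inter_preimage (ψ.open_source.preimage continuous_subtype_val)
    have hopen := Complex.isOpen_image_of_injOn (f := ψ ∘ j) hDo
      (ψ.continuousOn.comp (continuous_subtype_val.comp_continuousOn
        (h.continuousOn_symm.comp continuous_ofComplex.continuousOn fun w hw => hw.2.1))
        fun w hw => hw.2.2)
      (by
        intro w hw w' hw' hww
        have h1 := Subtype.ext (ψ.injOn hw.2.2 hw'.2.2 hww)
        have h2 := congrArg toComplex (h.symm.injOn hw.2.1 hw'.2.1 h1)
        rwa [toComplex_ofComplex hw.1.le, toComplex_ofComplex hw'.1.le] at h2)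
    have hsub : ψ.source ∩ ψ ⁻¹' (ψ ∘ j '' D) ⊆ Y := by
      rintro x ⟨hx, w, hw, hwx⟩
      rw [← ψ.injOn hw.2.2 hx hwx]
      exact (h.symm (ofComplex w)).2
    refine mem_interior.2 ⟨_, hsub, ψ.isOpen_inter_preimage hopen, hψ, toComplex (h p), ?_, ?_⟩
    · refine ⟨hre, ?_, ?_⟩
      · simpa using h.map_source hp
      · simpa [h.left_inv hp] using hψ
    · simp [j, h.left_inv hp]

/-- The half-disc `0 ≤ re`, `‖w‖ < 1`, which contains its diameter but not its half-circle. -/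
def halfDisc : Set ℂ := {w | 0 ≤ w.re ∧ ‖w‖ < 1}

/-- A homeomorphism `toFun` from a neighbourhood of `y` in `Y` to the half-disc, with inverse
`invFun`, sending `y` to the centre `0` and the points of the neighbourhood that are interior to `Y`
to the open half-disc. The neighbourhood is `nbhd ∩ Y` with `nbhd` open in `X`. -/
structure HalfDiscChart (Y : Set X) (y : X) where
  nbhd : Set X
  toFun : X → ℂ
  invFun : ℂ → X
  isOpen_nbhd : IsOpen nbhd
  mem_nbhd : y ∈ nbhd
  map_center : toFun y = 0
  mapsTo : Set.MapsTo toFun (nbhd ∩ Y) halfDisc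
  mapsTo_inv : Set.MapsTo invFun halfDisc (nbhd ∩ Y)
  left_inv : ∀ p ∈ nbhd ∩ Y, invFun (toFun p) = p
  right_inv : ∀ w ∈ halfDisc, toFun (invFun w) = w
  continuousOn : ContinuousOn toFun (nbhd ∩ Y)
  continuousOn_inv : ContinuousOn invFun halfDisc
  re_pos_iff : ∀ p ∈ nbhd ∩ Y, 0 < (toFun p).re ↔ p ∈ interior Y

/-- A boundary point of a surface with boundary has arbitrarily small half-disc charts. -/
theorem IsC0SurfaceWithBoundary.exists_halfDiscChart (hY : IsC0SurfaceWithBoundary Y)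
    (hX : ∀ x : X, ∃ ψ : OpenPartialHomeomorph X ℂ, x ∈ ψ.source) {y : X} (hy : y ∈ Y)
    (hyi : y ∉ interior Y) {W : Set X} (hW : IsOpen W) (hyW : y ∈ W) :
    ∃ c : HalfDiscChart Y y, c.nbhd ⊆ W := by
  obtain ⟨cs⟩ := hY
  let y' : Y := ⟨y, hy⟩
  let h : OpenPartialHomeomorph Y (EuclideanHalfSpace 2) := chartAt (EuclideanHalfSpace 2) y'
  have hys : y' ∈ h.source := mem_chart_source _ y'
  set o : ℂ := toComplex (h y') with ho
  have hint : ∀ p ∈ h.source, 0 < (toComplex (h p)).re ↔ (p : X) ∈ interior Y := fun p hp => by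
    obtain ⟨ψ, hψ⟩ := hX p
    exact (mem_interior_iff_of_halfPlane_chart h hp ψ hψ).symm
  have ho0 : o.re = 0 :=
    le_antisymm (not_lt.1 fun h0 => hyi ((hint y' hys).1 h0)) (toComplex_re_nonneg _)
  obtain ⟨δ, hδ, hball⟩ : ∃ δ > 0, ∀ w, dist w o < δ → ofComplex w ∈ h.target ∧
      ((h.symm (ofComplex w) : Y) : X) ∈ W := by
    have hopen : IsOpen (ofComplex ⁻¹' (h.target ∩ h.symm ⁻¹' ((↑) ⁻¹' W))) :=
      (h.symm.isOpen_inter_preimage (hW.preimage continuous_subtype_val)).preimage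
        continuous_ofComplex
    obtain ⟨δ, hδ, hb⟩ := Metric.isOpen_iff.1 hopen o (by
      simp [ho, h.map_source hys, h.left_inv hys, y', hyW])
    exact ⟨δ, hδ, fun w hw => hb hw⟩
  have hδ0 : (δ : ℂ) ≠ 0 := by exact_mod_cast hδ.ne'
  have hNo : IsOpen (h.source ∩ h ⁻¹' (toComplex ⁻¹' Metric.ball o δ)) :=
    h.isOpen_inter_preimage (Metric.isOpen_ball.preimage continuous_toComplex)
  obtain ⟨O, hO, hON⟩ := isOpen_induced_iff.1 hNo
  have hOmem : ∀ p : Y, (p : X) ∈ O ↔ p ∈ h.source ∧ dist (toComplex (h p)) o < δ := fun p => by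
    rw [← Set.mem_preimage, hON]
    rfl
  have hsub : (O ∩ W) ∩ Y ⊆ (↑) '' h.source := fun x hx =>
    ⟨⟨x, hx.2⟩, ((hOmem ⟨x, hx.2⟩).1 hx.1.1).1, rfl⟩
  have hscale : ∀ w ∈ halfDisc, dist (o + δ * w) o < δ ∧ 0 ≤ (o + δ * w).re := by
    rintro w ⟨hw0, hw1⟩
    refine ⟨?_, ?_⟩
    · rw [dist_eq_norm, add_sub_cancel_left, norm_mul, Complex.norm_real, Real.norm_eq_abs,
        abs_of_pos hδ]
      exact mul_lt_of_lt_one_right hδ hw1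
    · simp only [Complex.add_re, ho0, Complex.re_ofReal_mul, zero_add]
      positivity
  have hre : ∀ z : ℂ, ((z - o) / δ).re = z.re / δ := fun z => by
    rw [Complex.div_ofReal_re, Complex.sub_re, ho0, sub_zero]
  refine ⟨{
    nbhd := O ∩ W
    toFun := fun x => (complexCoord h x - o) / δ
    invFun := fun w => h.symm (ofComplex (o + δ * w))
    isOpen_nbhd := hO.inter hW
    mem_nbhd := ⟨(hOmem y').2 ⟨hys, by simpa [ho] using hδ⟩, hyW⟩
    map_center := ?_
    mapsTo := ?_
    mapsTo_inv := ?_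
    left_inv := ?_
    right_inv := ?_
    continuousOn := ?_
    continuousOn_inv := ?_
    re_pos_iff := ?_ }, Set.inter_subset_right⟩
  · have : complexCoord h y = o := complexCoord_coe h y'
    simp [this]
  · rintro x ⟨⟨hxO, hxW⟩, hxY⟩
    have h1 : complexCoord h x = _ := complexCoord_coe h ⟨x, hxY⟩
    refine ⟨?_, ?_⟩
    · rw [hre, h1]
      exact div_nonneg (toComplex_re_nonneg _) hδ.le
    · rw [norm_div, Complex.norm_real, Real.norm_eq_abs, abs_of_pos hδ, div_lt_one hδ, h1,
        ← dist_eq_norm]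
      exact ((hOmem ⟨x, hxY⟩).1 hxO).2
  · intro w hw
    obtain ⟨h1, h2⟩ := hscale w hw
    obtain ⟨h3, h4⟩ := hball _ h1
    refine ⟨⟨(hOmem _).2 ⟨h.map_target h3, ?_⟩, h4⟩, Subtype.coe_prop _⟩
    rwa [h.right_inv h3, toComplex_ofComplex h2]
  · rintro x hx
    have h1 : complexCoord h x = _ := complexCoord_coe h ⟨x, hx.2⟩
    have h2 := ((hOmem ⟨x, hx.2⟩).1 hx.1.1).1
    change ((h.symm (ofComplex (o + δ * ((complexCoord h x - o) / δ))) : Y) : X) = x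
    rw [mul_div_cancel₀ _ hδ0, add_sub_cancel, h1, ofComplex_toComplex, h.left_inv h2]
  · intro w hw
    obtain ⟨h1, h2⟩ := hscale w hw
    simp only [complexCoord_coe]
    rw [h.right_inv (hball _ h1).1, toComplex_ofComplex h2, add_sub_cancel_left,
      mul_div_cancel_left₀ _ hδ0]
  · exact (((continuousOn_complexCoord h).mono hsub).sub continuousOn_const).div_const _
  · refine continuous_subtype_val.comp_continuousOn (h.continuousOn_symm.comp ?_ ?_)
    · exact (continuous_ofComplex.comp (by fun_prop)).continuousOn
    · exact fun w hw => (hball _ (hscale w hw).1).1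
  · intro x hx
    have h1 : complexCoord h x = _ := complexCoord_coe h ⟨x, hx.2⟩
    have h2 := ((hOmem ⟨x, hx.2⟩).1 hx.1.1).1
    simp only [hre, h1]
    rw [div_pos_iff_of_pos_right hδ, hint _ h2]

end

/-! ### Arcs of small circles -/

section

variable {X : Type*} [TopologicalSpace X]

/-- The points `p` and `q` are joined within `S` by an arc, possibly winding several times, of the
circle of centre `c` and radius `r` in the chart `ψ`. -/
def ArcJoined (ψ : OpenPartialHomeomorph X ℂ) (S : Set X) (c : ℂ) (r : ℝ) (p q : X) : Prop :=
  ∃ θ₁ θ₂ : ℝ, ψ.symm (circleMap c r θ₁) = p ∧ ψ.symm (circleMap c r θ₂) = q ∧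
    ∀ θ ∈ Set.uIcc θ₁ θ₂, ψ.symm (circleMap c r θ) ∈ S

variable {ψ : OpenPartialHomeomorph X ℂ} {S : Set X} {c : ℂ} {r : ℝ}

theorem ArcJoined.symm {p q : X} (h : ArcJoined ψ S c r p q) : ArcJoined ψ S c r q p := by
  obtain ⟨θ₁, θ₂, h1, h2, h3⟩ := h
  exact ⟨θ₂, θ₁, h2, h1, by rwa [Set.uIcc_comm]⟩

theorem circleMap_add_int_mul_two_pi (c : ℂ) (r θ : ℝ) (n : ℤ) :
    circleMap c r (θ + n * (2 * Real.pi)) = circleMap c r θ :=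
  (periodic_circleMap c r).int_mul n θ

theorem ArcJoined.trans (hr : r ≠ 0) (hψ : Metric.sphere c |r| ⊆ ψ.target) {p q s : X}
    (h : ArcJoined ψ S c r p q) (h' : ArcJoined ψ S c r q s) : ArcJoined ψ S c r p s := by
  obtain ⟨θ₁, θ₂, h1, h2, h3⟩ := h
  obtain ⟨θ₃, θ₄, h4, h5, h6⟩ := h'
  have heq : circleMap c r θ₂ = circleMap c r θ₃ :=
    ψ.symm.injOn (hψ (circleMap_mem_sphere' _ _ _)) (hψ (circleMap_mem_sphere' _ _ _))
      (h2.trans h4.symm)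
  obtain ⟨n, hn⟩ := (circleMap_eq_circleMap_iff c hr).1 heq
  have hn' : θ₂ = θ₃ + n * (2 * Real.pi) := by
    have : ((θ₂ : ℝ) : ℂ) * Complex.I = ((θ₃ + n * (2 * Real.pi) : ℝ) : ℂ) * Complex.I := by
      rw [hn]
      push_cast
      ring
    exact_mod_cast mul_right_cancel₀ Complex.I_ne_zero this
  refine ⟨θ₁, θ₄ + n * (2 * Real.pi), h1, by rw [circleMap_add_int_mul_two_pi, h5], ?_⟩
  intro θ hθ
  rcases Set.uIcc_subset_uIcc_union_uIcc (b := θ₂) hθ with hθ | hθ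
  · exact h3 θ hθ
  · have := h6 (θ - n * (2 * Real.pi)) (by
      rw [hn', Set.mem_uIcc] at hθ
      rw [Set.mem_uIcc]
      rcases hθ with hθ | hθ
      · left; constructor <;> linarith [hθ.1, hθ.2]
      · right; constructor <;> linarith [hθ.1, hθ.2])
    rwa [← circleMap_add_int_mul_two_pi c r _ n, sub_add_cancel] at this

/-- An arc joining two points can be shortened to one that does not wind more than once. -/
theorem ArcJoined.exists_abs_sub_le {p q : X} (h : ArcJoined ψ S c r p q) :
    ∃ θ₁ θ₂ : ℝ, |θ₂ - θ₁| ≤ 2 * Real.pi ∧ ψ.symm (circleMap c r θ₁) = p ∧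
      ψ.symm (circleMap c r θ₂) = q ∧ ∀ θ ∈ Set.uIcc θ₁ θ₂, ψ.symm (circleMap c r θ) ∈ S := by
  wlog hle : ∃ θ₁ θ₂ : ℝ, θ₁ ≤ θ₂ ∧ ψ.symm (circleMap c r θ₁) = p ∧
      ψ.symm (circleMap c r θ₂) = q ∧ ∀ θ ∈ Set.uIcc θ₁ θ₂, ψ.symm (circleMap c r θ) ∈ S
    generalizing p q
  · obtain ⟨θ₁, θ₂, h1, h2, h3⟩ := h
    rcases le_total θ₁ θ₂ with h12 | h12
    · exact absurd ⟨θ₁, θ₂, h12, h1, h2, h3⟩ hle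
    · obtain ⟨η₁, η₂, h4, h5, h6, h7⟩ := this (p := q) (q := p)
        ⟨θ₂, θ₁, h2, h1, by rwa [Set.uIcc_comm]⟩ ⟨θ₂, θ₁, h12, h2, h1, by rwa [Set.uIcc_comm]⟩
      exact ⟨η₂, η₁, by rwa [abs_sub_comm], h6, h5, by rwa [Set.uIcc_comm]⟩
  obtain ⟨θ₁, θ₂, h12, h1, h2, h3⟩ := hle
  have hp := Real.two_pi_pos
  have hmem := toIcoMod_mem_Ico hp θ₁ θ₂
  have hle : toIcoMod hp θ₁ θ₂ ≤ θ₂ := by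
    have h0 : 0 ≤ toIcoDiv hp θ₁ θ₂ := by
      have : -1 < toIcoDiv hp θ₁ θ₂ := by
        have h4 := toIcoMod_add_toIcoDiv_zsmul hp θ₁ θ₂
        rw [zsmul_eq_mul] at h4
        have h5 : (-1 : ℝ) < (toIcoDiv hp θ₁ θ₂ : ℝ) := by
          by_contra! hcon
          nlinarith [hmem.2]
        exact_mod_cast h5
      omega
    have h4 := toIcoMod_add_toIcoDiv_zsmul hp θ₁ θ₂
    rw [zsmul_eq_mul] at h4
    have : (0 : ℝ) ≤ toIcoDiv hp θ₁ θ₂ := by exact_mod_cast h0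
    nlinarith
  refine ⟨θ₁, toIcoMod hp θ₁ θ₂, ?_, h1, ?_, fun θ hθ => h3 θ ?_⟩
  · rw [abs_of_nonneg (by linarith [hmem.1])]
    linarith [hmem.2]
  · rw [← h2, ← circleMap_add_int_mul_two_pi c r _ (toIcoDiv hp θ₁ θ₂), ← zsmul_eq_mul,
      toIcoMod_add_toIcoDiv_zsmul]
  · rw [Set.uIcc_of_le hmem.1] at hθ
    rw [Set.uIcc_of_le h12]
    exact ⟨hθ.1, hθ.2.trans hle⟩

/-- Points of the circle in the open set `S` are joined within `S` to all nearby points of the circle. -/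
theorem eventually_arcJoined (hr : 0 < r) (hS : IsOpen S) {p : X} (hp : p ∈ ψ.source)
    (hpS : p ∈ S) (hpr : dist (ψ p) c = r) :
    ∀ᶠ q in 𝓝 p, dist (ψ q) c = r → ArcJoined ψ S c r p q := by
  obtain ⟨θ₀, hθ₀⟩ : ψ p ∈ Set.range (circleMap c r) := by
    rw [range_circleMap, abs_of_pos hr]
    exact hpr
  have hp0 : ψ p - c ≠ 0 := by
    rw [← norm_pos_iff, ← dist_eq_norm, hpr]
    exact hr
  have hnear : ∀ᶠ θ in 𝓝 θ₀, ψ.symm (circleMap c r θ) ∈ S := by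
    have hc : ContinuousAt (fun θ => ψ.symm (circleMap c r θ)) θ₀ := by
      refine ContinuousAt.comp (g := ψ.symm) ?_ (continuous_circleMap c r).continuousAt
      rw [hθ₀]
      exact ψ.symm.continuousAt (ψ.map_source hp)
    apply hc.preimage_mem_nhds
    simp only [hθ₀, ψ.left_inv hp]
    exact hS.mem_nhds hpS
  obtain ⟨ε, hε, hball⟩ := Metric.eventually_nhds_iff.1 hnear
  have harg : ContinuousAt (fun q => Complex.arg ((ψ q - c) / (ψ p - c))) p := by
    refine ContinuousAt.comp (g := Complex.arg) ?_
      (((ψ.continuousAt hp).sub continuousAt_const).div_const _)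
    rw [div_self hp0]
    exact Complex.continuousAt_arg Complex.one_mem_slitPlane
  have h0 : Complex.arg ((ψ p - c) / (ψ p - c)) = 0 := by rw [div_self hp0, Complex.arg_one]
  have hlt : ∀ᶠ q in 𝓝 p, |Complex.arg ((ψ q - c) / (ψ p - c))| < ε := by
    have := harg.abs
    refine this.eventually_lt continuousAt_const ?_
    rw [h0, abs_zero]
    exact hε
  filter_upwards [hlt, ψ.open_source.mem_nhds hp] with q hq hqs hqr
  set ζ := (ψ q - c) / (ψ p - c) with hζ
  have hζ1 : ‖ζ‖ = 1 := by
    rw [hζ, norm_div, ← dist_eq_norm, ← dist_eq_norm, hqr, hpr, div_self hr.ne']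
  have hζe : Complex.exp (ζ.arg * Complex.I) = ζ := by
    have := Complex.norm_mul_exp_arg_mul_I ζ
    rwa [hζ1, Complex.ofReal_one, one_mul] at this
  refine ⟨θ₀, θ₀ + ζ.arg, by rw [hθ₀, ψ.left_inv hp], ?_, fun θ hθ => hball ?_⟩
  · have : circleMap c r (θ₀ + ζ.arg) = ψ q := by
      have h1 : circleMap c r (θ₀ + ζ.arg) = c + (circleMap c r θ₀ - c) * ζ := by
        conv_rhs => rw [← hζe]
        simp only [circleMap, Complex.ofReal_add, add_mul, Complex.exp_add]
        ring
      rw [h1, hθ₀, hζ, mul_div_cancel₀ _ hp0, add_sub_cancel]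
    rw [this, ψ.left_inv hqs]
  · rw [Real.dist_eq]
    have := Set.abs_sub_left_of_mem_uIcc hθ
    rw [add_sub_cancel_left] at this
    exact this.trans_lt hq

/-- A path in the interior which ends near the centre of a half-disc chart and starts outside the
chart has a final piece that lies in the chart and starts on the half-circle of radius `1 / 2`. -/
theorem HalfDiscChart.exists_tail [T2Space X] {Y : Set X} {y : X} (χ : HalfDiscChart Y y)
    {α : ℝ → X} (hα : ContinuousOn α (Set.Icc 0 1))
    (hαY : Set.MapsTo α (Set.Icc 0 1) (interior Y)) (h0 : α 0 ∉ χ.nbhd) (h1 : α 1 ∈ χ.nbhd)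
    (h1' : ‖χ.toFun (α 1)‖ < 1 / 2) :
    ∃ a ∈ Set.Icc (0 : ℝ) 1, (∀ t ∈ Set.Icc a 1, α t ∈ χ.nbhd) ∧
      ‖χ.toFun (α a)‖ = 1 / 2 := by
  obtain ⟨u, hu, hus⟩ := continuousOn_iff'.1 χ.continuousOn _
    (Metric.isOpen_ball (x := (0 : ℂ)) (ε := 1 / 2))
  have hmem : ∀ t ∈ Set.Icc (0 : ℝ) 1,
      α t ∈ χ.nbhd ∩ u ↔ α t ∈ χ.nbhd ∧ ‖χ.toFun (α t)‖ < 1 / 2 := by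
    intro t ht
    have hY : α t ∈ Y := interior_subset (hαY ht)
    have := Set.ext_iff.1 hus (α t)
    simp only [Set.mem_inter_iff, Set.mem_preimage, mem_ball_zero_iff, hY, and_true] at this
    simp only [Set.mem_inter_iff]
    tauto
  have hTc : IsClosed (Set.Icc (0 : ℝ) 1 ∩ α ⁻¹' (χ.nbhd ∩ u)ᶜ) :=
    hα.preimage_isClosed_of_isClosed isClosed_Icc (χ.isOpen_nbhd.inter hu).isClosed_compl
  obtain ⟨a, ⟨ha, haT⟩, hmax⟩ := (isCompact_Icc.of_isClosed_subset hTc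
    Set.inter_subset_left).exists_isGreatest ⟨0, by simp, fun h => h0 h.1⟩
  have hafter : ∀ t ∈ Set.Ioc a 1, α t ∈ χ.nbhd ∧ ‖χ.toFun (α t)‖ < 1 / 2 := by
    intro t ht
    have ht' : t ∈ Set.Icc (0 : ℝ) 1 := ⟨ha.1.trans ht.1.le, ht.2⟩
    rw [← hmem t ht']
    by_contra hcon
    exact absurd (hmax ⟨ht', hcon⟩) (not_le.2 ht.1)
  have ha1 : a < 1 := by
    refine lt_of_le_of_ne ha.2 ?_
    rintro rfl
    exact haT ((hmem 1 ha).2 ⟨h1, h1'⟩)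
  -- the compact half-disc of radius `1 / 2` contains the limit point `α a`
  have hDc : IsCompact (Metric.closedBall (0 : ℂ) (1 / 2) ∩ {w | 0 ≤ w.re}) :=
    (isCompact_closedBall _ _).inter_right (isClosed_le continuous_const Complex.continuous_re)
  have hDs : Metric.closedBall (0 : ℂ) (1 / 2) ∩ {w | 0 ≤ w.re} ⊆ halfDisc := fun w hw =>
    ⟨hw.2, by have := mem_closedBall_zero_iff.1 hw.1; linarith⟩
  have hKc := (hDc.image_of_continuousOn (χ.continuousOn_inv.mono hDs)).isClosed
  have haK : α a ∈ χ.invFun '' (Metric.closedBall (0 : ℂ) (1 / 2) ∩ {w | 0 ≤ w.re}) := by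
    have hcl : a ∈ closure (Set.Ioc a 1) := by
      rw [closure_Ioc ha1.ne]
      exact ⟨le_rfl, ha1.le⟩
    have hsub : Set.Ioc a 1 ⊆ Set.Icc (0 : ℝ) 1 := fun t ht => ⟨ha.1.trans ht.1.le, ht.2⟩
    refine hKc.closure_subset_iff.2 ?_ (((hα a ha).mono hsub).mem_closure_image hcl)
    rintro _ ⟨t, ht, rfl⟩
    have hmY : α t ∈ χ.nbhd ∩ Y := ⟨(hafter t ht).1, interior_subset (hαY (hsub ht))⟩
    exact ⟨χ.toFun (α t), ⟨mem_closedBall_zero_iff.2 (hafter t ht).2.le, (χ.mapsTo hmY).1⟩,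
      χ.left_inv _ hmY⟩
  obtain ⟨w, hw, hwa⟩ := haK
  have han : α a ∈ χ.nbhd := hwa ▸ (χ.mapsTo_inv (hDs hw)).1
  refine ⟨a, ha, fun t ht => ?_, ?_⟩
  · rcases ht.1.eq_or_lt with rfl | h
    · exact han
    · exact (hafter t ⟨h, ht.2⟩).1
  · refine le_antisymm ?_ (not_lt.1 fun h => haT ((hmem a ha).2 ⟨han, h⟩))
    rw [← hwa, χ.right_inv w (hDs hw)]
    exact mem_closedBall_zero_iff.1 hw.1

end

/-! ### Connecting two paths near a boundary point -/

theorem IsPreconnected.preimage_subtypeVal {X : Type*} [TopologicalSpace X] {s V : Set X}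
    (hs : IsPreconnected s) (hsV : s ⊆ V) : IsPreconnected (((↑) : V → X) ⁻¹' s) := by
  rw [← Topology.IsInducing.subtypeVal.isPreconnected_image, Subtype.image_preimage_coe,
    Set.inter_eq_self_of_subset_right hsV]
  exact hs

theorem isPreconnected_half_circle :
    IsPreconnected {w : ℂ | 0 < w.re ∧ ‖w‖ = 1 / 2} := by
  have h : {w : ℂ | 0 < w.re ∧ ‖w‖ = 1 / 2} =
      (fun t : ℝ => (⟨√(1 / 4 - t ^ 2), t⟩ : ℂ)) '' Set.Ioo (-1 / 2) (1 / 2) := by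
    ext w
    have hn : ‖w‖ = 1 / 2 ↔ w.re ^ 2 + w.im ^ 2 = 1 / 4 := by
      rw [← sq_eq_sq₀ (norm_nonneg _) (by norm_num), ← Complex.normSq_eq_norm_sq,
        Complex.normSq_apply]
      constructor <;> intro h <;> linarith
    simp only [Set.mem_ofPred_eq, Set.mem_image, hn]
    constructor
    · rintro ⟨h1, h2⟩
      refine ⟨w.im, ⟨by nlinarith, by nlinarith⟩, Complex.ext ?_ rfl⟩
      rw [Real.sqrt_eq_iff_mul_self_eq (by nlinarith) h1.le]
      linarith
    · rintro ⟨t, ht, rfl⟩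
      have h0 : 0 < 1 / 4 - t ^ 2 := by nlinarith [ht.1, ht.2]
      refine ⟨Real.sqrt_pos.2 h0, ?_⟩
      simp only
      rw [Real.sq_sqrt h0.le]
      ring
  rw [h]
  refine isPreconnected_Ioo.image _ (Continuous.continuousOn ?_)
  have : (fun t : ℝ => (⟨√(1 / 4 - t ^ 2), t⟩ : ℂ)) =
      fun t => ((√(1 / 4 - t ^ 2) : ℝ) : ℂ) + (t : ℂ) * Complex.I := by
    ext1 t
    apply Complex.ext <;> simp
  rw [this]
  fun_prop

/-- Two paths in `Int Y` from far away to points close to the boundary point `y` are connected by an arc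
of any small circle about `y`, within `Int Y`. -/
theorem exists_arcJoined_of_paths {X : Type*} [TopologicalSpace X] [T2Space X] {Y : Set X}
    (hY : IsC0SurfaceWithBoundary Y)
    (hX : ∀ x : X, ∃ ψ : OpenPartialHomeomorph X ℂ, x ∈ ψ.source) {x y z : X} (hy : y ∈ Y)
    (hyi : y ∉ interior Y) (hx : x ≠ y) (hz : z ≠ y) {ψ : OpenPartialHomeomorph X ℂ}
    (hψ : y ∈ ψ.source) :
    ∃ R > 0, ∀ r, 0 < r → r < R → ∃ N ∈ 𝓝 y, ∃ U ∈ 𝓝 x, ∃ V ∈ 𝓝 z, ∀ α β : ℝ → X,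
      ContinuousOn α (Set.Icc 0 1) → ContinuousOn β (Set.Icc 0 1) →
      Set.MapsTo α (Set.Icc 0 1) (interior Y) → Set.MapsTo β (Set.Icc 0 1) (interior Y) →
      α 0 ∈ U → β 0 ∈ V → α 1 ∈ N → β 1 ∈ N →
      ∃ s ∈ Set.Icc (0 : ℝ) 1, ∃ t ∈ Set.Icc (0 : ℝ) 1,
        ArcJoined ψ (interior Y) (ψ y) r (α s) (β t) := by
  obtain ⟨U₁, W₁, hU₁, hW₁, hxU, hyW₁, hd₁⟩ := t2_separation hx
  obtain ⟨U₂, W₂, hU₂, hW₂, hzU, hyW₂, hd₂⟩ := t2_separation hz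
  obtain ⟨χ, hχ⟩ := hY.exists_halfDiscChart hX hy hyi
    ((hW₁.inter hW₂).inter ψ.open_source) ⟨⟨hyW₁, hyW₂⟩, hψ⟩
  let d : ℂ → ℝ := fun w => dist (ψ (χ.invFun w)) (ψ y)
  have hsrc : ∀ w ∈ halfDisc, χ.invFun w ∈ ψ.source := fun w hw => (hχ (χ.mapsTo_inv hw).1).2
  have hd : ContinuousOn d halfDisc :=
    continuous_dist.comp_continuousOn
      ((ψ.continuousOn.comp χ.continuousOn_inv hsrc).prodMk continuousOn_const)
  have hyχ : y ∈ χ.nbhd ∩ Y := ⟨χ.mem_nbhd, hy⟩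
  have h0 : (0 : ℂ) ∈ halfDisc := by simp [halfDisc]
  have hinv0 : χ.invFun 0 = y := by rw [← χ.map_center, χ.left_inv y hyχ]
  have hd0 : d 0 = 0 := by simp [d, hinv0]
  -- a lower bound for the distance from `y` on the half-circle
  obtain ⟨R₀, hR₀, hdR₀⟩ : ∃ R₀ > 0, ∀ w : ℂ, 0 ≤ w.re → ‖w‖ = 1 / 2 → R₀ ≤ d w := by
    have hKc : IsCompact (Metric.sphere (0 : ℂ) (1 / 2) ∩ {w | 0 ≤ w.re}) :=
      (isCompact_sphere _ _).inter_right (isClosed_le continuous_const Complex.continuous_re)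
    have hKs : Metric.sphere (0 : ℂ) (1 / 2) ∩ {w | 0 ≤ w.re} ⊆ halfDisc := fun w hw =>
      ⟨hw.2, by have := mem_sphere_zero_iff_norm.1 hw.1; linarith⟩
    obtain ⟨R₀, hR₀, hle⟩ := hKc.exists_forall_le' (hd.mono hKs) (a := 0) (fun w hw => by
      refine dist_pos.2 fun heq => ?_
      have h1 := ψ.injOn (hsrc w (hKs hw)) hψ heq
      have h2 := χ.right_inv w (hKs hw)
      rw [h1, χ.map_center] at h2
      have h3 := mem_sphere_zero_iff_norm.1 hw.1
      rw [← h2, norm_zero] at h3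
      norm_num at h3)
    exact ⟨R₀, hR₀, fun w h1 h2 => hle w ⟨by simpa using h2, h1⟩⟩
  obtain ⟨R₁, hR₁, hball⟩ := Metric.nhds_basis_closedBall.mem_iff.1
    (ψ.open_target.mem_nhds (ψ.map_source hψ))
  refine ⟨min R₀ R₁, lt_min hR₀ hR₁, fun r hr hrR => ?_⟩
  have hsphere : Metric.sphere (ψ y) |r| ⊆ ψ.target := by
    rw [abs_of_pos hr]
    exact Metric.sphere_subset_closedBall.trans ((Metric.closedBall_subset_closedBall
      (hrR.le.trans (min_le_right _ _))).trans hball)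
  obtain ⟨s, hs, hs2, hds⟩ : ∃ s > 0, s ≤ 1 / 2 ∧ ∀ w ∈ halfDisc, ‖w‖ < s → d w < r := by
    obtain ⟨s, hs, h⟩ := Metric.continuousOn_iff.1 hd 0 h0 r hr
    refine ⟨min s (1 / 2), by positivity, min_le_right _ _, fun w hw hws => ?_⟩
    have := h w hw (by rw [dist_zero_right]; exact hws.trans_le (min_le_left _ _))
    rw [hd0, dist_zero_right] at this
    exact (le_abs_self _).trans_lt this
  have hN : {p | p ∈ χ.nbhd ∧ (p ∈ Y → ‖χ.toFun p‖ < s)} ∈ 𝓝 y := by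
    have h1 : ∀ᶠ p in 𝓝[χ.nbhd ∩ Y] y, ‖χ.toFun p‖ < s := by
      have := (χ.continuousOn y hyχ).norm
      refine this.eventually_lt continuousWithinAt_const ?_
      simpa [χ.map_center] using hs
    filter_upwards [eventually_nhdsWithin_iff.1 h1, χ.isOpen_nbhd.mem_nhds χ.mem_nbhd]
      with p hp hpn
    exact ⟨hpn, fun hpY => hp ⟨hpn, hpY⟩⟩
  refine ⟨_, hN, U₁, hU₁.mem_nhds hxU, U₂, hU₂.mem_nhds hzU, ?_⟩
  intro α β hα hβ hαY hβY hα0 hβ0 hα1 hβ1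
  by_contra! hno
  have hone : (1 : ℝ) ∈ Set.Icc (0 : ℝ) 1 := by simp
  have hα1s := hα1.2 (interior_subset (hαY hone))
  have hβ1s := hβ1.2 (interior_subset (hβY hone))
  obtain ⟨a, ha, hαχ, haw⟩ := χ.exists_tail hα hαY
    (fun h => Set.disjoint_left.1 hd₁ hα0 (hχ h).1.1) hα1.1 (hα1s.trans_le hs2)
  obtain ⟨b, hb, hβχ, hbw⟩ := χ.exists_tail hβ hβY
    (fun h => Set.disjoint_left.1 hd₂ hβ0 (hχ h).1.2) hβ1.1 (hβ1s.trans_le hs2)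
  have hasub : Set.Icc a 1 ⊆ Set.Icc (0 : ℝ) 1 := Set.Icc_subset_Icc_left ha.1
  have hbsub : Set.Icc b 1 ⊆ Set.Icc (0 : ℝ) 1 := Set.Icc_subset_Icc_left hb.1
  -- the open half-disc
  set V : Set ℂ := {w | 0 < w.re} ∩ Metric.ball 0 1 with hV
  have hVsub : ∀ w ∈ V, w ∈ halfDisc := fun w hw => ⟨hw.1.le, by simpa using hw.2⟩
  have hVconv : Convex ℝ V := (convex_halfSpace_re_gt 0).inter (convex_ball _ _)
  have hVopen : IsOpen V :=
    (isOpen_lt continuous_const Complex.continuous_re).inter Metric.isOpen_ball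
  have hVint : ∀ w ∈ V, χ.invFun w ∈ interior Y := fun w hw => by
    rw [← χ.re_pos_iff _ (χ.mapsTo_inv (hVsub w hw)), χ.right_inv w (hVsub w hw)]
    exact hw.1
  have hmemV : ∀ p ∈ χ.nbhd, p ∈ interior Y → χ.toFun p ∈ V := fun p hp hpY => by
    have h1 : p ∈ χ.nbhd ∩ Y := ⟨hp, interior_subset hpY⟩
    exact ⟨(χ.re_pos_iff p h1).2 hpY, by simpa using (χ.mapsTo h1).2⟩
  have hαV : ∀ t ∈ Set.Icc a 1, χ.toFun (α t) ∈ V := fun t ht =>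
    hmemV _ (hαχ t ht) (hαY (hasub ht))
  have hβV : ∀ t ∈ Set.Icc b 1, χ.toFun (β t) ∈ V := fun t ht =>
    hmemV _ (hβχ t ht) (hβY (hbsub ht))
  have hαinv : ∀ t ∈ Set.Icc a 1, χ.invFun (χ.toFun (α t)) = α t := fun t ht =>
    χ.left_inv _ ⟨hαχ t ht, interior_subset (hαY (hasub ht))⟩
  have hβinv : ∀ t ∈ Set.Icc b 1, χ.invFun (χ.toFun (β t)) = β t := fun t ht =>
    χ.left_inv _ ⟨hβχ t ht, interior_subset (hβY (hbsub ht))⟩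
  have ha1 : (1 : ℝ) ∈ Set.Icc a 1 := ⟨ha.2, le_rfl⟩
  have hb1 : (1 : ℝ) ∈ Set.Icc b 1 := ⟨hb.2, le_rfl⟩
  have haa : a ∈ Set.Icc a 1 := ⟨le_rfl, ha.2⟩
  have hbb : b ∈ Set.Icc b 1 := ⟨le_rfl, hb.2⟩
  have := hVconv.contractibleSpace ⟨_, hαV 1 ha1⟩
  have := hVopen.locallyPathConnectedSpace
  let u : V → ℝ := fun v => d v
  have hu : Continuous u := (hd.mono hVsub).comp_continuous continuous_subtype_val Subtype.prop
  have hinvc : Continuous fun v : V => χ.invFun v :=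
    (χ.continuousOn_inv.mono hVsub).comp_continuous continuous_subtype_val Subtype.prop
  let P : V → Prop := fun v =>
    ∃ t ∈ Set.Icc a 1, ArcJoined ψ (interior Y) (ψ y) r (α t) (χ.invFun v)
  -- moving along the level set `u = r` a little does not change `P`
  have hloc : ∀ v₀ : V, u v₀ = r → ∀ᶠ v in 𝓝 v₀, u v = r →
      ArcJoined ψ (interior Y) (ψ y) r (χ.invFun v₀) (χ.invFun v) := fun v₀ hv₀ =>
    hinvc.continuousAt.eventually (eventually_arcJoined hr isOpen_interior
      (hsrc _ (hVsub _ v₀.2)) (hVint _ v₀.2) hv₀)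
  have hclosed : ∀ Q : V → Prop, (∀ v v' : V, ArcJoined ψ (interior Y) (ψ y) r (χ.invFun v)
      (χ.invFun v') → Q v' → Q v) → IsClosed {v | u v = r ∧ Q v} := by
    intro Q hQ
    refine isClosed_of_closure_subset fun v₀ hv₀ => ?_
    have hv₀r : u v₀ = r :=
      closure_minimal (fun v hv => hv.1) (isClosed_eq hu continuous_const) hv₀
    obtain ⟨v, ⟨hv, hQv⟩, hv'⟩ :=
      ((mem_closure_iff_frequently.1 hv₀).and_eventually (hloc v₀ hv₀r)).exists
    exact ⟨hv₀r, hQ _ _ (hv' hv) hQv⟩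
  have hA : IsClosed {v | u v = r ∧ P v} := hclosed P fun v v' hvv' ⟨t, ht, h⟩ =>
    ⟨t, ht, h.trans hr.ne' hsphere hvv'.symm⟩
  have hB : IsClosed {v | u v = r ∧ ¬ P v} := hclosed _ fun v v' hvv' h ⟨t, ht, h'⟩ =>
    h ⟨t, ht, h'.trans hr.ne' hsphere hvv'⟩
  have hχc : ∀ γ : ℝ → X, ∀ e : ℝ, ContinuousOn γ (Set.Icc e 1) →
      (∀ t ∈ Set.Icc e 1, γ t ∈ χ.nbhd ∩ Y) →
      IsPreconnected ((fun t => χ.toFun (γ t)) '' Set.Icc e 1) := fun γ e hγ hm =>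
    isPreconnected_Icc.image _ (χ.continuousOn.comp hγ hm)
  have hE₁ : IsPreconnected (((↑) : V → ℂ) ⁻¹' ((fun t => χ.toFun (α t)) '' Set.Icc a 1)) := by
    refine IsPreconnected.preimage_subtypeVal (hχc α a (hα.mono hasub) fun t ht =>
      ⟨hαχ t ht, interior_subset (hαY (hasub ht))⟩) ?_
    rintro _ ⟨t, ht, rfl⟩
    exact hαV t ht
  have hseg : segment ℝ (χ.toFun (α 1)) (χ.toFun (β 1)) ⊆ V ∩ Metric.ball 0 s :=
    (hVconv.inter (convex_ball _ _)).segment_subset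
      ⟨hαV 1 ha1, by simpa using hα1s⟩ ⟨hβV 1 hb1, by simpa using hβ1s⟩
  have hE₂ : IsPreconnected (((↑) : V → ℂ) ⁻¹' (segment ℝ (χ.toFun (α 1)) (χ.toFun (β 1)) ∪
      (fun t => χ.toFun (β t)) '' Set.Icc b 1 ∪ {w : ℂ | 0 < w.re ∧ ‖w‖ = 1 / 2})) := by
    refine IsPreconnected.preimage_subtypeVal ?_ ?_
    · refine IsPreconnected.union (χ.toFun (β b)) (Or.inr ⟨b, hbb, rfl⟩)
        ⟨(hβV b hbb).1, hbw⟩ ?_ isPreconnected_half_circle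
      refine IsPreconnected.union (χ.toFun (β 1)) (right_mem_segment ℝ _ _) ⟨1, hb1, rfl⟩
        (convex_segment _ _).isPreconnected ?_
      exact hχc β b (hβ.mono hbsub) fun t ht =>
        ⟨hβχ t ht, interior_subset (hβY (hbsub ht))⟩
    · rintro w ((hw | ⟨t, ht, rfl⟩) | hw)
      · exact (hseg hw).1
      · exact hβV t ht
      · exact ⟨hw.1, by rw [mem_ball_zero_iff, hw.2]; norm_num⟩
  have hfinal := not_separated_of_disjoint_closed hu hA hB
    (Set.disjoint_left.2 fun v h h' => h'.2 h.2)
    (fun v hv => (em (P v)).imp (⟨hv, ·⟩) (⟨hv, ·⟩)) hE₁ hE₂ ?_ ?_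
    (p := ⟨χ.toFun (α 1), hαV 1 ha1⟩) (q := ⟨χ.toFun (α a), hαV a haa⟩)
    ⟨1, ha1, rfl⟩ (Or.inl (Or.inl (left_mem_segment ℝ _ _))) ⟨a, haa, rfl⟩
    (Or.inr ⟨(hαV a haa).1, haw⟩) (hds _ (hVsub _ (hαV 1 ha1)) hα1s)
  · exact absurd ((hdR₀ _ (hαV a haa).1.le haw).trans hfinal)
      (not_le.2 (hrR.trans_le (min_le_left _ _)))
  · refine Set.disjoint_left.2 ?_
    rintro v ⟨t, ht, htv⟩ ⟨hvr, hvP⟩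
    refine hvP ⟨t, ht, ?_⟩
    have h1 := (hloc v hvr).self_of_nhds hvr
    simp only at htv
    rwa [← htv, hαinv t ht] at h1 ⊢
  · refine Set.disjoint_left.2 ?_
    rintro v ((hv | ⟨t', ht', htv⟩) | hv) ⟨hvr, t, ht, hP⟩
    · have := hds v (hVsub v v.2) (by simpa using (hseg hv).2)
      exact this.ne hvr
    · simp only at htv
      rw [← htv, hβinv t' ht'] at hP
      exact hno t (hasub ht) t' (hbsub ht') hP
    · have := hdR₀ v hv.1.le hv.2
      exact absurd (this.trans hvr.le) (not_le.2 (hrR.trans_le (min_le_left _ _)))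

/-! ### The infimum of lengths of smooth paths -/

section

open Manifold

variable {X : Type*} [TopologicalSpace X] [ChartedSpace (EuclideanSpace ℝ (Fin 2)) X]
  [RiemannianBundle (fun x : X => TangentSpace (𝓡 2) x)]

theorem smoothPathInf_le {S : Set X} {γ : ℝ → X}
    (hγ : ContMDiffOn 𝓘(ℝ, ℝ) (𝓡 2) ∞ γ (Set.Icc 0 1)) (hS : Set.MapsTo γ (Set.Icc 0 1) S) :
    smoothPathInf S (γ 0) (γ 1) ≤ pathELength (𝓡 2) γ 0 1 :=
  sInf_le ⟨γ, hγ, hS, rfl, rfl, rfl⟩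

theorem exists_path_of_smoothPathInf_lt {S : Set X} {x y : X} {r : ℝ≥0∞}
    (h : smoothPathInf S x y < r) : ∃ γ : ℝ → X,
      ContMDiffOn 𝓘(ℝ, ℝ) (𝓡 2) ∞ γ (Set.Icc 0 1) ∧ Set.MapsTo γ (Set.Icc 0 1) S ∧
      γ 0 = x ∧ γ 1 = y ∧ pathELength (𝓡 2) γ 0 1 < r := by
  obtain ⟨_, ⟨γ, h1, h2, h3, h4, rfl⟩, h5⟩ := sInf_lt_iff.1 h
  exact ⟨γ, h1, h2, h3, h4, h5⟩

theorem smoothPathInf_comp_le {S : Set X} {γ : ℝ → X}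
    (hγ : ContMDiffOn 𝓘(ℝ, ℝ) (𝓡 2) ∞ γ (Set.Icc 0 1)) (hS : Set.MapsTo γ (Set.Icc 0 1) S)
    {f : ℝ → ℝ} (hf : ContDiff ℝ ∞ f) (hf01 : Set.MapsTo f (Set.Icc 0 1) (Set.Icc 0 1)) :
    smoothPathInf S (γ (f 0)) (γ (f 1)) ≤ pathELength (𝓡 2) (γ ∘ f) 0 1 :=
  smoothPathInf_le (γ := γ ∘ f) (hγ.comp hf.contMDiff.contMDiffOn hf01) (hS.comp hf01)

theorem smoothPathInf_left_le {S : Set X} {γ : ℝ → X}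
    (hγ : ContMDiffOn 𝓘(ℝ, ℝ) (𝓡 2) ∞ γ (Set.Icc 0 1)) (hS : Set.MapsTo γ (Set.Icc 0 1) S)
    {t : ℝ} (ht : t ∈ Set.Icc (0 : ℝ) 1) :
    smoothPathInf S (γ 0) (γ t) ≤ pathELength (𝓡 2) γ 0 1 := by
  have hf : ContDiff ℝ ∞ fun s : ℝ => t * s := by fun_prop
  have h := smoothPathInf_comp_le hγ hS hf fun s hs =>
    ⟨mul_nonneg ht.1 hs.1, mul_le_one₀ ht.2 hs.1 hs.2⟩
  rw [pathELength_comp_of_monotoneOn zero_le_one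
    ((monotone_mul_left_of_nonneg ht.1).monotoneOn _) (hf.differentiable (by simp)).differentiableOn]
    at h
  · simp only [mul_zero, mul_one] at h
    exact h.trans (pathELength_mono le_rfl ht.2)
  · simp only [mul_zero, mul_one]
    exact (hγ.mdifferentiableOn (by simp)).mono (Set.Icc_subset_Icc_right ht.2)

theorem smoothPathInf_comm (S : Set X) (x y : X) : smoothPathInf S x y = smoothPathInf S y x := by
  suffices H : ∀ x y, smoothPathInf S y x ≤ smoothPathInf S x y from le_antisymm (H y x) (H x y)
  intro x y
  refine le_of_forall_gt fun r hr => ?_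
  obtain ⟨γ, hγ, hS, rfl, rfl, hlen⟩ := exists_path_of_smoothPathInf_lt hr
  have hf : ContDiff ℝ ∞ fun s : ℝ => 1 - s := by fun_prop
  have h := smoothPathInf_comp_le hγ hS hf fun s hs => ⟨by linarith [hs.2], by linarith [hs.1]⟩
  rw [pathELength_comp_of_antitoneOn zero_le_one (fun a _ b _ hab => sub_le_sub_left hab 1)
    (hf.differentiable (by simp)).differentiableOn] at h
  · simp only [sub_zero, sub_self] at h
    exact h.trans_lt hlen
  · simpa using hγ.mdifferentiableOn (by simp)

theorem smoothPathInf_self {S : Set X} {x : X} (hx : x ∈ S) : smoothPathInf S x x = 0 := by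
  have h := smoothPathInf_left_le (S := S) (γ := fun _ => x) contMDiffOn_const
    (fun _ _ => hx) (t := 0) (by simp)
  refine le_antisymm (h.trans ?_) bot_le
  have : (fun _ : ℝ => x) = (fun _ : ℝ => x) ∘ fun _ : ℝ => (0 : ℝ) := rfl
  rw [this, pathELength_comp_of_monotoneOn zero_le_one (monotone_const.monotoneOn _)
    (differentiable_const _).differentiableOn
    ((contMDiffOn_const (n := 1)).mdifferentiableOn (by simp)), pathELength_self]

/-- A smooth path may be reparametrized so as to be constant near its ends. -/
theorem exists_locally_constant_of_smoothPathInf_lt {S : Set X} {x y : X} {r : ℝ≥0∞}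
    (h : smoothPathInf S x y < r) : ∃ γ : ℝ → X, ContMDiff 𝓘(ℝ, ℝ) (𝓡 2) ∞ γ ∧
      (∀ t, γ t ∈ S) ∧ (∀ t ≤ 1 / 3, γ t = x) ∧ (∀ t, 2 / 3 ≤ t → γ t = y) ∧
      pathELength (𝓡 2) γ 0 1 < r := by
  obtain ⟨γ, hγ, hS, rfl, rfl, hlen⟩ := exists_path_of_smoothPathInf_lt h
  let η : ℝ → ℝ := fun t => Real.smoothTransition (3 * (t - 1 / 3))
  have hη : ContDiff ℝ ∞ η := by fun_prop
  have hη01 : ∀ t, η t ∈ Set.Icc (0 : ℝ) 1 := fun t =>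
    ⟨Real.smoothTransition.nonneg _, Real.smoothTransition.le_one _⟩
  have hη0 : ∀ t ≤ 1 / 3, η t = 0 := fun t ht =>
    Real.smoothTransition.zero_of_nonpos (by linarith)
  have hη1 : ∀ t, 2 / 3 ≤ t → η t = 1 := fun t ht =>
    Real.smoothTransition.one_of_one_le (by linarith)
  have hmono : Monotone η := fun s t hst =>
    Real.smoothTransition.monotone (by linarith)
  refine ⟨γ ∘ η, ?_, fun t => hS (hη01 t), fun t ht => by simp [hη0 t ht],
    fun t ht => by simp [hη1 t ht], ?_⟩
  · rw [← contMDiffOn_univ]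
    exact hγ.comp hη.contMDiff.contMDiffOn fun t _ => hη01 t
  · have e0 : η 0 = 0 := hη0 0 (by norm_num)
    have e1 : η 1 = 1 := hη1 1 (by norm_num)
    rw [pathELength_comp_of_monotoneOn zero_le_one (hmono.monotoneOn _)
      (hη.differentiable (by simp)).differentiableOn, e0, e1]
    · exact hlen
    · rw [e0, e1]
      exact hγ.mdifferentiableOn (by simp)

theorem smoothPathInf_triangle (S : Set X) (x y z : X) :
    smoothPathInf S x z ≤ smoothPathInf S x y + smoothPathInf S y z := by
  refine le_of_forall_gt fun r hr => ?_
  obtain ⟨a, ha, b, hb, hab⟩ := ENNReal.exists_add_lt_of_add_lt hr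
  obtain ⟨γ₁, hγ₁, hS₁, h₁0, h₁1, hl₁⟩ := exists_locally_constant_of_smoothPathInf_lt ha
  obtain ⟨γ₂, hγ₂, hS₂, h₂0, h₂1, hl₂⟩ := exists_locally_constant_of_smoothPathInf_lt hb
  -- the second path is run on `[1, 2]`, then everything is rescaled
  let σ : ℝ → ℝ := fun t => t - 1
  have hσ : ContDiff ℝ ∞ σ := by fun_prop
  have hγσ : ContMDiff 𝓘(ℝ, ℝ) (𝓡 2) ∞ (γ₂ ∘ σ) := hγ₂.comp hσ.contMDiff
  let γ : ℝ → X := Set.piecewise (Set.Iic 1) γ₁ (γ₂ ∘ σ)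
  have hγ : ContMDiff 𝓘(ℝ, ℝ) (𝓡 2) ∞ γ := by
    refine ContMDiff.piecewise_Iic hγ₁ hγσ ?_
    filter_upwards [Ioo_mem_nhds (show (2 / 3 : ℝ) < 1 by norm_num)
      (show (1 : ℝ) < 4 / 3 by norm_num)] with t ht
    rw [h₁1 t ht.1.le, Function.comp_apply, h₂0 _ (by simp only [σ]; linarith [ht.2])]
  have hγS : ∀ t, γ t ∈ S := fun t => by
    by_cases h : t ∈ Set.Iic (1 : ℝ)
    · simp only [γ, Set.piecewise_eq_of_mem _ _ _ h, hS₁]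
    · simp only [γ, Set.piecewise_eq_of_notMem _ _ _ h, Function.comp_apply, hS₂]
  have hlen : pathELength (𝓡 2) γ 0 2 < r := by
    rw [← pathELength_add zero_le_one one_le_two]
    refine lt_of_eq_of_lt ?_ ((ENNReal.add_lt_add hl₁ hl₂).trans hab)
    congr 1
    · exact pathELength_congr fun t ht => Set.piecewise_eq_of_mem _ _ _ ht.2
    · have : pathELength (𝓡 2) γ 1 2 = pathELength (𝓡 2) (γ₂ ∘ σ) 1 2 :=
        pathELength_congr_Ioo fun t ht => Set.piecewise_eq_of_notMem _ _ _ (not_le.2 ht.1)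
      rw [this, pathELength_comp_of_monotoneOn one_le_two (fun a _ b _ hab => by simpa [σ] using hab)
        (hσ.differentiable (by simp)).differentiableOn
        (hγ₂.mdifferentiable (by simp)).mdifferentiableOn]
      norm_num [σ]
  have hf : ContDiff ℝ ∞ fun s : ℝ => 2 * s := by fun_prop
  have h := smoothPathInf_le (S := S) (γ := γ ∘ fun s => 2 * s)
    (hγ.comp hf.contMDiff).contMDiffOn fun t _ => hγS _
  rw [pathELength_comp_of_monotoneOn zero_le_one
    ((monotone_mul_left_of_nonneg zero_le_two).monotoneOn _)
    (hf.differentiable (by simp)).differentiableOn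
    (hγ.mdifferentiable (by simp)).mdifferentiableOn] at h
  have e0 : γ 0 = x := by
    simp only [γ]
    rw [Set.piecewise_eq_of_mem _ _ _ (by simp), h₁0 0 (by norm_num)]
  have e2 : γ 2 = z := by
    simp only [γ]
    rw [Set.piecewise_eq_of_notMem _ _ _ (by simp), Function.comp_apply,
      h₂1 _ (by norm_num [σ])]
  simp only [Function.comp_apply, mul_zero, mul_one, e0, e2] at h
  exact h.trans_lt hlen

theorem riemannianEDist_le_smoothPathInf (S : Set X) (x y : X) :
    riemannianEDist (𝓡 2) x y ≤ smoothPathInf S x y := by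
  refine le_sInf ?_
  rintro _ ⟨γ, hγ, -, h0, h1, rfl⟩
  exact riemannianEDist_le_pathELength (hγ.of_le (by simp)) h0 h1 zero_le_one

end

section

open Manifold

variable {X : Type*} [TopologicalSpace X] [ChartedSpace (EuclideanSpace ℝ (Fin 2)) X]
  [IsManifold (𝓡 2) ∞ X] [RiemannianBundle (fun x : X => TangentSpace (𝓡 2) x)]
  [IsContinuousRiemannianBundle (EuclideanSpace ℝ (Fin 2))
      (fun x : X => TangentSpace (𝓡 2) x)]

/-- Near the centre of a chart, the derivative of the inverse chart is bounded. The bound is stated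
vector by vector, so that only the norms of the model space and of the fibres are involved. -/
theorem eventually_enorm_mfderivWithin_symm_apply_le (x : X) : ∃ C : NNReal, ∀ᶠ w in 𝓝[Set.range (𝓡 2)] (extChartAt (𝓡 2) x x),
    ∀ v : EuclideanSpace ℝ (Fin 2),
      ‖mfderivWithin (𝓡 2) (𝓡 2) (extChartAt (𝓡 2) x).symm (Set.range (𝓡 2)) w v‖ₑ ≤
        C * ‖v‖ₑ := by
  obtain ⟨C, hC0, hC⟩ := eventually_norm_symmL_trivializationAt_lt (EuclideanSpace ℝ (Fin 2))
    (fun x : X => TangentSpace (𝓡 2) x) x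
  have h1 : ∀ᶠ y in 𝓝 x, ∀ v : EuclideanSpace ℝ (Fin 2),
      ‖mfderivWithin (𝓡 2) (𝓡 2) (extChartAt (𝓡 2) x).symm (Set.range (𝓡 2))
        (extChartAt (𝓡 2) x y) v‖ₑ ≤ C.toNNReal * ‖v‖ₑ := by
    filter_upwards [hC, chart_source_mem_nhds (EuclideanSpace ℝ (Fin 2)) x] with y hy hys v
    have h := ContinuousLinearMap.le_of_opNorm_le _ hy.le v
    rw [TangentBundle.symmL_trivializationAt hys] at h
    -- the fibre norms at `p` and at `y` live on types that agree only after substitution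
    have hcast : ∀ p : X, p = y → ∀ u : EuclideanSpace ℝ (Fin 2),
        @norm (TangentSpace (𝓡 2) p) _ u = @norm (TangentSpace (𝓡 2) y) _ u := by
      rintro p rfl u
      rfl
    have h2 := (hcast _ ((extChartAt (𝓡 2) x).left_inv (by simpa using hys)) _).trans_le h
    rw [← ofReal_norm, ← ofReal_norm, ← ENNReal.ofReal, ← ENNReal.ofReal_mul hC0.le]
    exact ENNReal.ofReal_le_ofReal h2
  have hx : (extChartAt (𝓡 2) x).symm (extChartAt (𝓡 2) x x) = x := by simp
  have h2 := (continuousAt_extChartAt_symm (I := 𝓡 2) x).eventually (by rwa [hx])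
  refine ⟨C.toNNReal, ?_⟩
  filter_upwards [nhdsWithin_le_nhds h2, extChartAt_target_mem_nhdsWithin x] with w hw hwt v
  rw [(extChartAt (𝓡 2) x).right_inv hwt] at hw
  exact hw v

/-- Near the centre of a chart, the length of a path is controlled by its speed in the chart. -/
theorem exists_smoothPathInf_le_chart (x : X) :
    ∃ C : NNReal, ∃ R > 0, ∀ (S : Set X) (η : ℝ → EuclideanSpace ℝ (Fin 2)) (M : NNReal),
      ContDiff ℝ ∞ η → (∀ t ∈ Set.Icc (0 : ℝ) 1, η t ∈ Metric.ball (extChartAt (𝓡 2) x x) R) →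
      (∀ t ∈ Set.Icc (0 : ℝ) 1, ‖deriv η t‖₊ ≤ M) →
      (∀ t ∈ Set.Icc (0 : ℝ) 1, (extChartAt (𝓡 2) x).symm (η t) ∈ S) →
      smoothPathInf S ((extChartAt (𝓡 2) x).symm (η 0)) ((extChartAt (𝓡 2) x).symm (η 1)) ≤
        C * M := by
  obtain ⟨C, hC⟩ := eventually_enorm_mfderivWithin_symm_apply_le x
  obtain ⟨R, hR, hball⟩ := Metric.mem_nhdsWithin_iff.1
    (Filter.inter_mem (extChartAt_target_mem_nhdsWithin (I := 𝓡 2) x) hC)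
  refine ⟨C, R, hR, fun S η M hη hηR hηM hηS => ?_⟩
  have hgood : ∀ t ∈ Set.Icc (0 : ℝ) 1, η t ∈ (extChartAt (𝓡 2) x).target ∧
      ∀ v : EuclideanSpace ℝ (Fin 2), ‖mfderivWithin (𝓡 2) (𝓡 2) (extChartAt (𝓡 2) x).symm
        (Set.range (𝓡 2)) (η t) v‖ₑ ≤ C * ‖v‖ₑ :=
    fun t ht => hball ⟨hηR t ht, by simp⟩
  have hηs : ContMDiffOn 𝓘(ℝ, ℝ) (𝓡 2) ∞ η (Set.Icc 0 1) := hη.contMDiff.contMDiffOn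
  have hγ : ContMDiffOn 𝓘(ℝ, ℝ) (𝓡 2) ∞ ((extChartAt (𝓡 2) x).symm ∘ η) (Set.Icc 0 1) :=
    (contMDiffOn_extChartAt_symm x).comp hηs fun t ht => (hgood t ht).1
  refine (smoothPathInf_le (γ := (extChartAt (𝓡 2) x).symm ∘ η) hγ hηS).trans ?_
  rw [pathELength_eq_lintegral_mfderivWithin_Icc]
  have hbound : ∀ t ∈ Set.Icc (0 : ℝ) 1,
      ‖mfderivWithin 𝓘(ℝ, ℝ) (𝓡 2) ((extChartAt (𝓡 2) x).symm ∘ η) (Set.Icc 0 1) t 1‖ₑ ≤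
        (C : ℝ≥0∞) * M := by
    intro t ht
    have h1 : mfderivWithin 𝓘(ℝ, ℝ) (𝓡 2) ((extChartAt (𝓡 2) x).symm ∘ η) (Set.Icc 0 1) t =
        (mfderivWithin (𝓡 2) (𝓡 2) (extChartAt (𝓡 2) x).symm (Set.range (𝓡 2)) (η t)) ∘L
          (mfderivWithin 𝓘(ℝ, ℝ) (𝓡 2) η (Set.Icc 0 1) t) := by
      apply mfderivWithin_comp
      · exact mdifferentiableWithinAt_extChartAt_symm (hgood t ht).1
      · exact hηs.mdifferentiableOn (by simp) t ht
      · exact fun s hs => by simp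
      · rw [uniqueMDiffWithinAt_iff_uniqueDiffWithinAt]
        exact uniqueDiffOn_Icc zero_lt_one t ht
    have h2 : mfderivWithin 𝓘(ℝ, ℝ) (𝓡 2) ((extChartAt (𝓡 2) x).symm ∘ η) (Set.Icc 0 1) t 1 =
        (mfderivWithin (𝓡 2) (𝓡 2) (extChartAt (𝓡 2) x).symm (Set.range (𝓡 2)) (η t))
          (mfderivWithin 𝓘(ℝ, ℝ) (𝓡 2) η (Set.Icc 0 1) t 1) := congr($h1 1)
    have h3 : mfderivWithin 𝓘(ℝ, ℝ) (𝓡 2) η (Set.Icc 0 1) t 1 = deriv η t := by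
      rw [mfderivWithin_eq_fderivWithin, (hη.differentiable (by simp) t).fderivWithin
        (uniqueDiffOn_Icc zero_lt_one t ht)]
      rfl
    rw [h2, h3]
    refine ((hgood t ht).2 _).trans (mul_le_mul_right ?_ _)
    exact ENNReal.coe_le_coe.2 (hηM t ht)
  calc _ ≤ ∫⁻ _ in Set.Icc (0 : ℝ) 1, (C : ℝ≥0∞) * M :=
        MeasureTheory.setLIntegral_mono' measurableSet_Icc hbound
    _ = C * M := by simp

end

/-! ### The triangle inequality at a point -/

section

open Manifold

variable {X : Type*} [TopologicalSpace X] [ChartedSpace (EuclideanSpace ℝ (Fin 2)) X]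

/-- The preferred chart of a surface at a point, with values in the complex plane. -/
noncomputable def complexChartAt (x : X) : OpenPartialHomeomorph X ℂ :=
  (chartAt (EuclideanSpace ℝ (Fin 2)) x).transHomeomorph
    Complex.orthonormalBasisOneI.repr.symm.toHomeomorph

theorem mem_complexChartAt_source (x : X) : x ∈ (complexChartAt x).source :=
  mem_chart_source (EuclideanSpace ℝ (Fin 2)) x

theorem complexChartAt_symm_apply (x : X) (w : ℂ) : (complexChartAt x).symm w =
    (extChartAt (𝓡 2) x).symm (Complex.orthonormalBasisOneI.repr w) := by
  simp [complexChartAt, mfld_simps]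

theorem complexChartAt_apply (x y : X) : Complex.orthonormalBasisOneI.repr (complexChartAt x y) =
    extChartAt (𝓡 2) x y :=
  Complex.orthonormalBasisOneI.repr.apply_symm_apply _

variable [IsManifold (𝓡 2) ∞ X] [RiemannianBundle (fun x : X => TangentSpace (𝓡 2) x)]
  [IsContinuousRiemannianBundle (EuclideanSpace ℝ (Fin 2))
      (fun x : X => TangentSpace (𝓡 2) x)]

/-- Arcs of small circles are short. -/
theorem exists_smoothPathInf_le_of_arcJoined (y : X) : ∃ C : NNReal, ∃ R > 0, ∀ r, 0 < r → r < R →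
    ∀ (S : Set X) (p q : X), ArcJoined (complexChartAt y) S (complexChartAt y y) r p q →
      smoothPathInf S p q ≤ C * ENNReal.ofReal r := by
  obtain ⟨C, R, hR, hC⟩ := exists_smoothPathInf_le_chart y
  refine ⟨C * (2 * Real.pi).toNNReal, R, hR, fun r hr hrR S p q h => ?_⟩
  obtain ⟨θ₁, θ₂, hθ, rfl, rfl, hS⟩ := h.exists_abs_sub_le
  let L := Complex.orthonormalBasisOneI.repr
  let σ : ℝ → ℝ := fun t => θ₁ + t * (θ₂ - θ₁)
  let η : ℝ → EuclideanSpace ℝ (Fin 2) := fun t => L (circleMap (complexChartAt y y) r (σ t))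
  have hσ : ContDiff ℝ ∞ σ := by fun_prop
  have hη : ContDiff ℝ ∞ η := L.contDiff.comp ((contDiff_circleMap _ _).comp hσ)
  have hderiv : ∀ t, ‖deriv η t‖ = r * |θ₂ - θ₁| := by
    intro t
    have h1 : HasDerivAt σ (θ₂ - θ₁) t := by
      have h0 := ((hasDerivAt_id t).mul_const (θ₂ - θ₁)).const_add θ₁
      rwa [one_mul] at h0
    have h2 := (hasDerivAt_circleMap (complexChartAt y y) r (σ t)).scomp t h1
    have h3 := (L.toContinuousLinearEquiv.toContinuousLinearMap.hasFDerivAt.comp_hasDerivAt t h2)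
    have h4 : deriv η t = L ((θ₂ - θ₁) • (circleMap 0 r (σ t) * Complex.I)) := h3.deriv
    rw [h4, L.norm_map, norm_smul, norm_mul, norm_circleMap_zero, Complex.norm_I,
      abs_of_pos hr, Real.norm_eq_abs]
    ring
  have key := hC S η (r * (2 * Real.pi)).toNNReal hη (fun t _ => ?_) (fun t _ => ?_)
    (fun t ht => ?_)
  · have e : ∀ t, (extChartAt (𝓡 2) y).symm (η t) =
        (complexChartAt y).symm (circleMap (complexChartAt y y) r (σ t)) := fun t =>
      (complexChartAt_symm_apply _ _).symm
    rw [e, e] at key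
    simp only [σ, zero_mul, add_zero, one_mul, add_sub_cancel] at key
    refine key.trans_eq ?_
    rw [mul_comm r, Real.toNNReal_mul Real.two_pi_pos.le, ENNReal.coe_mul, ENNReal.coe_mul,
      mul_assoc]
    rfl
  · rw [Metric.mem_ball, ← complexChartAt_apply]
    simp only [η, L]
    rw [LinearIsometryEquiv.dist_map, dist_eq_norm, circleMap_sub_center, norm_circleMap_zero,
      abs_of_pos hr]
    exact hrR
  · rw [← NNReal.coe_le_coe, coe_nnnorm, hderiv, Real.coe_toNNReal _ (by positivity)]
    exact mul_le_mul_of_nonneg_left hθ hr.le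
  · rw [show (extChartAt (𝓡 2) y).symm (η t) = _ from (complexChartAt_symm_apply _ _).symm]
    refine hS _ ?_
    have : σ t ∈ segment ℝ θ₁ θ₂ := by
      rw [segment_eq_image_lineMap]
      exact ⟨t, ht, by simp [σ, AffineMap.lineMap_apply, add_comm]⟩
    rwa [segment_eq_uIcc] at this

theorem eventually_smoothPathInf_le {S : Set X} {y : X} (hy : y ∈ interior S) {ε : ℝ≥0∞}
    (hε : 0 < ε) : ∃ N ∈ 𝓝 y, ∀ p ∈ N, ∀ q ∈ N, smoothPathInf (interior S) p q ≤ ε := by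
  obtain ⟨C, R, hR, hC⟩ := exists_smoothPathInf_le_chart y
  set φ := extChartAt (𝓡 2) y with hφ
  obtain ⟨δ, hδ, hδε⟩ : ∃ δ : NNReal, 0 < δ ∧ (C : ℝ≥0∞) * δ ≤ ε := by
    have h1 : Filter.Tendsto (fun δ : ℝ≥0∞ => (C : ℝ≥0∞) * δ) (𝓝 0) (𝓝 (C * 0)) :=
      ENNReal.Tendsto.const_mul Filter.tendsto_id (Or.inr ENNReal.coe_ne_top)
    rw [mul_zero] at h1
    obtain ⟨δ, hδ, h⟩ := (ENNReal.nhds_zero_basis_Iic.eventually_iff).1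
      (h1.eventually (ge_mem_nhds hε))
    obtain ⟨δ', h0, h2⟩ := ENNReal.lt_iff_exists_nnreal_btwn.1 hδ
    exact ⟨δ', by exact_mod_cast h0, h h2.le⟩
  have hpre : φ.symm ⁻¹' interior S ∈ 𝓝 (φ y) := by
    refine (continuousAt_extChartAt_symm y).preimage_mem_nhds ?_
    rw [extChartAt_to_inv]
    exact isOpen_interior.mem_nhds hy
  obtain ⟨ρ, hρ, hball⟩ := Metric.mem_nhds_iff.1 hpre
  set m := min (min R ρ) (δ / 2) with hm
  have hm0 : 0 < m := by positivity
  refine ⟨φ.source ∩ φ ⁻¹' Metric.ball (φ y) m, Filter.inter_mem (extChartAt_source_mem_nhds y)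
    ((continuousAt_extChartAt y).preimage_mem_nhds (Metric.ball_mem_nhds _ hm0)), ?_⟩
  rintro p ⟨hp, hpm⟩ q ⟨hq, hqm⟩
  have hseg : ∀ t ∈ Set.Icc (0 : ℝ) 1, AffineMap.lineMap (φ p) (φ q) t ∈ Metric.ball (φ y) m :=
    fun t ht => (convex_ball _ _).lineMap_mem hpm hqm ht
  have key := hC (interior S) (fun t => AffineMap.lineMap (φ p) (φ q) t) δ
    ((ContinuousAffineMap.lineMap (R := ℝ) (φ p) (φ q)).contDiff)
    (fun t ht => Metric.ball_subset_ball ((min_le_left _ _).trans (min_le_left _ _)) (hseg t ht))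
    (fun t _ => ?_)
    (fun t ht => hball (Metric.ball_subset_ball ((min_le_left _ _).trans (min_le_right _ _))
      (hseg t ht)))
  · simp only [AffineMap.lineMap_apply_zero, AffineMap.lineMap_apply_one] at key
    rw [φ.left_inv hp, φ.left_inv hq] at key
    exact key.trans hδε
  · rw [(AffineMap.hasDerivAt_lineMap (a := φ p) (b := φ q) (x := t)).deriv, ← NNReal.coe_le_coe,
      coe_nnnorm, ← dist_eq_norm]
    have h1 := dist_triangle_right (φ q) (φ p) (φ y)
    have h2 : dist (φ q) (φ y) < δ / 2 := (Metric.mem_ball.1 hqm).trans_le (min_le_right _ _)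
    have h3 : dist (φ p) (φ y) < δ / 2 := (Metric.mem_ball.1 hpm).trans_le (min_le_right _ _)
    linarith

variable [T2Space X]

/-- Two paths in the interior which start near `x` and near `z` and end near `y` can be combined to
a path of almost the same total length from the start of one to the start of the other. -/
theorem exists_nhds_smoothPathInf_le_add {Y : Set X} (hY : IsC0SurfaceWithBoundary Y) {x y z : X}
    (hy : y ∈ Y) (hx : x ≠ y) (hz : z ≠ y) {ε : ℝ≥0∞} (hε : 0 < ε) :
    ∃ N ∈ 𝓝 y, ∃ U ∈ 𝓝 x, ∃ V ∈ 𝓝 z, ∀ x' ∈ U, ∀ z' ∈ V, ∀ y₁ ∈ N, ∀ y₂ ∈ N,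
      smoothPathInf (interior Y) x' z' ≤
        smoothPathInf (interior Y) x' y₁ + smoothPathInf (interior Y) z' y₂ + ε := by
  by_cases hyi : y ∈ interior Y
  · obtain ⟨N, hN, h⟩ := eventually_smoothPathInf_le hyi hε
    refine ⟨N, hN, Set.univ, Filter.univ_mem, Set.univ, Filter.univ_mem, ?_⟩
    intro x' _ z' _ y₁ hy₁ y₂ hy₂
    calc smoothPathInf (interior Y) x' z'
        ≤ smoothPathInf (interior Y) x' y₁ + smoothPathInf (interior Y) y₁ z' :=
          smoothPathInf_triangle _ _ _ _
      _ ≤ smoothPathInf (interior Y) x' y₁ + (smoothPathInf (interior Y) y₁ y₂ +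
          smoothPathInf (interior Y) y₂ z') := by
          gcongr
          exact smoothPathInf_triangle _ _ _ _
      _ ≤ smoothPathInf (interior Y) x' y₁ + (ε + smoothPathInf (interior Y) z' y₂) := by
          rw [smoothPathInf_comm _ y₂]
          gcongr
          exact h _ hy₁ _ hy₂
      _ = _ := by ring
  · obtain ⟨R₁, hR₁, h₁⟩ := exists_arcJoined_of_paths hY
      (fun x => ⟨complexChartAt x, mem_complexChartAt_source x⟩) hy hyi hx hz
      (mem_complexChartAt_source y)
    obtain ⟨C, R₂, hR₂, h₂⟩ := exists_smoothPathInf_le_of_arcJoined y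
    obtain ⟨r, hr, hr₁, hr₂, hrε⟩ : ∃ r > 0, r < R₁ ∧ r < R₂ ∧
        (C : ℝ≥0∞) * ENNReal.ofReal r ≤ ε := by
      have ht : Filter.Tendsto (fun r : ℝ => (C : ℝ≥0∞) * ENNReal.ofReal r) (𝓝[>] 0)
          (𝓝 (C * ENNReal.ofReal 0)) :=
        (ENNReal.Tendsto.const_mul (ENNReal.continuous_ofReal.tendsto 0)
          (Or.inr ENNReal.coe_ne_top)).mono_left nhdsWithin_le_nhds
      rw [ENNReal.ofReal_zero, mul_zero] at ht
      have hlt : ∀ R > (0 : ℝ), ∀ᶠ r in 𝓝[>] (0 : ℝ), r < R := fun R hR =>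
        nhdsWithin_le_nhds (Iio_mem_nhds hR)
      obtain ⟨r, h1, h2, h3, h4⟩ := (((ht.eventually (ge_mem_nhds hε)).and
        ((hlt _ hR₁).and ((hlt _ hR₂).and self_mem_nhdsWithin)))).exists
      exact ⟨r, h4, h2, h3, h1⟩
    obtain ⟨N, hN, U, hU, V, hV, h⟩ := h₁ r hr hr₁
    refine ⟨N, hN, U, hU, V, hV, ?_⟩
    intro x' hx' z' hz' y₁ hy₁ y₂ hy₂
    refine le_of_forall_gt fun s hs => ?_
    obtain ⟨s', hs', e, he, hse⟩ := ENNReal.exists_add_lt_of_add_lt hs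
    obtain ⟨a, ha, b, hb, hab⟩ := ENNReal.exists_add_lt_of_add_lt hs'
    obtain ⟨α, hα, hαY, rfl, rfl, hαl⟩ := exists_path_of_smoothPathInf_lt ha
    obtain ⟨β, hβ, hβY, rfl, rfl, hβl⟩ := exists_path_of_smoothPathInf_lt hb
    obtain ⟨s, hs, t, ht, harc⟩ := h α β hα.continuousOn hβ.continuousOn hαY hβY hx' hz' hy₁ hy₂
    calc smoothPathInf (interior Y) (α 0) (β 0)
        ≤ smoothPathInf (interior Y) (α 0) (α s) + smoothPathInf (interior Y) (α s) (β 0) :=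
          smoothPathInf_triangle _ _ _ _
      _ ≤ smoothPathInf (interior Y) (α 0) (α s) + (smoothPathInf (interior Y) (α s) (β t) +
          smoothPathInf (interior Y) (β t) (β 0)) := by
          gcongr
          exact smoothPathInf_triangle _ _ _ _
      _ ≤ a + (ε + b) := by
          rw [smoothPathInf_comm _ (β t)]
          gcongr
          · exact (smoothPathInf_left_le hα hαY hs).trans hαl.le
          · exact (h₂ r hr hr₂ _ _ _ harc).trans hrε
          · exact (smoothPathInf_left_le hβ hβY ht).trans hβl.le
      _ = (a + b) + ε := by ring
      _ ≤ s' + e := by gcongr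
      _ < _ := hse

end

/-! ### Properties of `intrinsicRho` -/

section

open Manifold

variable {X : Type*} [TopologicalSpace X] [ChartedSpace (EuclideanSpace ℝ (Fin 2)) X]
  [RiemannianBundle (fun x : X => TangentSpace (𝓡 2) x)]

theorem intrinsicRho_comm (Y : Set X) (x y : X) : intrinsicRho Y x y = intrinsicRho Y y x := by
  rw [intrinsicRho, intrinsicRho, Filter.prod_comm, Filter.liminf, Filter.map_map, Filter.liminf]
  congr 2
  ext1 p
  exact smoothPathInf_comm _ _ _

/-- The limit inferior along a trivial filter is `⊤`, so a finite `intrinsicRho Y x x` means that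
`x` is a limit of interior points. -/
theorem neBot_of_intrinsicRho_lt_top {Y : Set X} {x : X} (h : intrinsicRho Y x x < ⊤) :
    (𝓝[interior Y] x).NeBot := by
  refine ⟨fun hbot => ?_⟩
  rw [intrinsicRho, hbot, Filter.bot_prod, Filter.liminf_bot] at h
  exact lt_irrefl _ h

theorem intrinsicRho_self {Y : Set X} {x : X} (h : (𝓝[interior Y] x).NeBot) :
    intrinsicRho Y x x = 0 := by
  refine le_antisymm (Filter.liminf_le_of_frequently_le' ?_) bot_le
  rw [Filter.frequently_iff]
  intro T hT
  obtain ⟨A, hA, B, hB, hAB⟩ := Filter.mem_prod_iff.1 hT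
  obtain ⟨p, ⟨hpA, hpB⟩, hp⟩ := h.nonempty_of_mem
    (Filter.inter_mem (Filter.inter_mem hA hB) self_mem_nhdsWithin)
  exact ⟨(p, p), hAB ⟨hpA, hpB⟩, (smoothPathInf_self hp).le⟩

variable [IsManifold (𝓡 2) ∞ X] [T2Space X] [IsContinuousRiemannianBundle
  (EuclideanSpace ℝ (Fin 2)) (fun x : X => TangentSpace (𝓡 2) x)]

theorem riemannianEDist_le_intrinsicRho (Y : Set X) (x y : X) :
    riemannianEDist (𝓡 2) x y ≤ intrinsicRho Y x y := by
  have : LocallyCompactSpace X := ChartedSpace.locallyCompactSpace (EuclideanSpace ℝ (Fin 2)) X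
  let : PseudoEMetricSpace X := PseudoEMetricSpace.ofRiemannianMetric (𝓡 2) X
  refine le_of_forall_lt fun c hc => ?_
  obtain ⟨c', hcc', hc'⟩ := exists_between hc
  refine hcc'.trans_le (Filter.le_liminf_of_le (by isBoundedDefault) ?_)
  have hcont : ContinuousAt (fun p : X × X => edist p.1 p.2) (x, y) :=
    continuous_edist.continuousAt
  have hev : ∀ᶠ p in 𝓝 (x, y), c' < edist p.1 p.2 :=
    hcont.eventually (lt_mem_nhds hc')
  rw [nhds_prod_eq] at hev
  filter_upwards [Filter.prod_mono nhdsWithin_le_nhds nhdsWithin_le_nhds hev] with p hp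
  exact hp.le.trans (riemannianEDist_le_smoothPathInf _ _ _)

theorem eq_of_intrinsicRho_eq_zero {Y : Set X} {x y : X} (h : intrinsicRho Y x y = 0) : x = y := by
  have : LocallyCompactSpace X := ChartedSpace.locallyCompactSpace (EuclideanSpace ℝ (Fin 2)) X
  let : EMetricSpace X := EMetricSpace.ofRiemannianMetric (𝓡 2) X
  refine eq_of_edist_eq_zero (le_antisymm ?_ bot_le)
  rw [← h]
  exact riemannianEDist_le_intrinsicRho Y x y

/-- The triangle inequality at a point `y` of `Y`. The points `x` and `z` differ from `y` so that paths
starting near them have to enter a neighbourhood of `y`. -/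
theorem intrinsicRho_triangle {Y : Set X} (hY : IsC0SurfaceWithBoundary Y) {x y z : X}
    (hy : y ∈ Y) (hx : x ≠ y) (hz : z ≠ y) :
    intrinsicRho Y x z ≤ intrinsicRho Y x y + intrinsicRho Y y z := by
  refine le_of_forall_gt fun r hr => ?_
  obtain ⟨a, ha, b, hb, hab⟩ := ENNReal.exists_add_lt_of_add_lt hr
  obtain ⟨ε, hε, habε⟩ := ENNReal.lt_iff_exists_add_pos_lt.1 hab
  rw [gt_iff_lt, intrinsicRho_comm] at hb
  refine lt_of_le_of_lt (Filter.liminf_le_of_frequently_le' ?_) habε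
  obtain ⟨N, hN, U, hU, V, hV, h⟩ := exists_nhds_smoothPathInf_le_add hY hy hx hz
    (ε := (ε : ℝ≥0∞)) (by exact_mod_cast hε)
  rw [Filter.frequently_iff]
  intro T hT
  obtain ⟨A, hA, B, hB, hAB⟩ := Filter.mem_prod_iff.1 hT
  obtain ⟨p, hp, hpa⟩ := (Filter.frequently_lt_of_liminf_lt (by isBoundedDefault) ha).and_eventually
    (Filter.prod_mem_prod (Filter.inter_mem hA (nhdsWithin_le_nhds hU)) (nhdsWithin_le_nhds hN))
    |>.exists
  obtain ⟨q, hq, hqb⟩ := (Filter.frequently_lt_of_liminf_lt (by isBoundedDefault) hb).and_eventually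
    (Filter.prod_mem_prod (Filter.inter_mem hB (nhdsWithin_le_nhds hV)) (nhdsWithin_le_nhds hN))
    |>.exists
  refine ⟨(p.1, q.1), hAB ⟨hpa.1.1, hqb.1.1⟩, ?_⟩
  refine (h p.1 hpa.1.2 q.1 hqb.1.2 p.2 hpa.2 q.2 hqb.2).trans ?_
  gcongr

end

theorem theorem3p1 {X : Type*} [TopologicalSpace X] [T2Space X] [SecondCountableTopology X]
    [ConnectedSpace X] [ChartedSpace (EuclideanSpace ℝ (Fin 2)) X] [IsManifold (𝓡 2) ∞ X]
    [RiemannianBundle (fun x : X => TangentSpace (𝓡 2) x)]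
    [IsContMDiffRiemannianBundle (𝓡 2) ∞ (EuclideanSpace ℝ (Fin 2))
      (fun x : X => TangentSpace (𝓡 2) x)]
    (Y : Set X) (hYcompact : IsCompact Y) (hYconn : IsConnected Y)
    (hY : IsC0SurfaceWithBoundary Y)
    (hfin : ∀ x ∈ Y, ∀ y ∈ Y, intrinsicRho Y x y < ⊤) :
    ∃ _ : MetricSpace Y, ∀ x y : Y, intrinsicRho Y (x : X) (y : X) = ENNReal.ofReal (dist x y) := by
  have : IsContinuousRiemannianBundle (EuclideanSpace ℝ (Fin 2))
      (fun x : X => TangentSpace (𝓡 2) x) := by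
    obtain ⟨g, hg, hg'⟩ := IsContMDiffRiemannianBundle.exists_contMDiff (IB := 𝓡 2) (n := ∞)
      (F := EuclideanSpace ℝ (Fin 2)) (E := fun x : X => TangentSpace (𝓡 2) x)
    exact ⟨⟨g, hg.continuous, hg'⟩⟩
  have hself : ∀ x : Y, intrinsicRho Y (x : X) x = 0 := fun x =>
    intrinsicRho_self (neBot_of_intrinsicRho_lt_top (hfin x x.2 x x.2))
  have htri : ∀ x y z : Y,
      intrinsicRho Y (x : X) z ≤ intrinsicRho Y (x : X) y + intrinsicRho Y (y : X) z := by
    intro x y z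
    rcases eq_or_ne (x : X) y with hxy | hxy
    · rw [hxy]
      exact le_add_self
    rcases eq_or_ne (z : X) y with hzy | hzy
    · rw [hzy]
      exact le_self_add
    exact intrinsicRho_triangle hY y.2 hxy hzy
  have hne : ∀ x y : Y, intrinsicRho Y (x : X) y ≠ ⊤ := fun x y => (hfin x x.2 y y.2).ne
  exact ⟨{
    dist := fun x y => (intrinsicRho Y (x : X) y).toReal
    dist_self := fun x => by simp [hself]
    dist_comm := fun x y => by simp [intrinsicRho_comm Y (x : X) y]
    dist_triangle := fun x y z => by
      rw [← ENNReal.toReal_add (hne x y) (hne y z)]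
      exact ENNReal.toReal_mono (ENNReal.add_ne_top.2 ⟨hne x y, hne y z⟩) (htri x y z)
    eq_of_dist_eq_zero := fun {x y} h => Subtype.ext (eq_of_intrinsicRho_eq_zero
      (((ENNReal.toReal_eq_zero_iff _).1 h).resolve_right (hne x y))) },
    fun x y => (ENNReal.ofReal_toReal (hne x y)).symm⟩
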